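/- Let $q$ be a prime power, let $r\mid q-1$, and let $p_1<p_2$ be primes with $p_2\nmid (q^{p_1}-1)/r$. Let $$n=\Phi_{p_1p_2}(q)=\frac{q^{p_1p_2}-1}{\operatorname{lcm}(q^{p_1}-1,q^{p_2}-1)},\qquad m=p_1p_2,\qquad s=\frac{\operatorname{lcm}(q^{p_1}-1,q^{p_2}-1)}{r},$$ so that $nr=(q^m-1)/s$. Represent the integers modulo $nr$ by $\{1,2,\dots,nr\}$, let $Z_{n,r}=\{1+ir: 0\le i\le n-1\}$, and let $C_i=\{iq^j \bmod nr: j\ge 0\}$ be the $q$-cyclotomic coset of $i$ modulo $nr$; its least element is its leader. For $l\ge1$ let $N_l$ be the number of cosets of size $l$ contained in $Z_{n,r}$, ordered by their leaders. (a) $\{|C_i| : i\in Z_{n,r}\}=\{1,p_1p_2\}$, with $N_1=1$ and $N_{p_1p_2}=(n-1)/(p_1p_2)$. (b) Let $\lambda\in\mathbb F_q$ have multiplicative order $r$. There is a primitive $nr$-th root of unity $\beta$ in an algebraic closure of $\mathbb F_q$ with $\beta^n=\lambda$, and for every such $\beta$ the following holds. Recall that a $\lambda$-constacyclic code of length $n$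 over $\mathbb F_q$ is an ideal $\langle g(x)\rangle$ of $\mathbb F_q[x]/(x^n-\lambda)$ with $g$ a monic divisor of $x^n-\lambda$, that its defining set is $\{j\in Z_{n,r}: g(\beta^j)=0\}$, and that an $[n,k,\ge d]$ code has length $n$, dimension $k$ and any two distinct codewords at Hamming distance at least $d$ (no condition on the zero code). The $\lambda$-constacyclic code whose defining set is the union of the first $\lceil N_1/2\rceil$ cosets of size $1$ and the first $\lceil N_m/2\rceil$ cosets of size $m$ in $Z_{n,r}$ exists and is an $$\left[n,\ n-1-p_1p_2\left\lceil\frac{n-1}{2p_1p_2}\right\rceil,\ \ge \left\lceil\frac{q\lceil (n-1)/(2p_1p_2)\rceil}{q-1}\right\rceil+\Lambda_{p_1p_2}\right]$$ code. Here $\Lambda_m=\lceil q|S_m|/(q-1)\rceil-1$, where $S_m$ is the set of all triples of integers $(i,j,t)$ with $\frac{m+1}2\le i\le\lfloor m-\log_q(s+1)\rfloor$, $1\le j\le q-1$, $0\le t<\frac{q^i-j(q^{m-i}-1)-1}{q^{m-i+1}-q}$, $q^i+qt+j\equiv1\pmod r$ and $q^i+qt+j\le 1+\left(\left\lceil \frac{q\lceil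 N_m/2\rceil}{q-1}\right\rceil-2\right)r$. (c) If moreover $r\le3$ or $2p_1p_2(q-1)\ge qr$, then for all $\lambda$ and $\beta$ as in (b) the $\lambda$-constacyclic code whose defining set is the union of the first $\lfloor N_1/2\rfloor$ cosets of size $1$ and the first $\lfloor N_m/2\rfloor$ cosets of size $m$ in $Z_{n,r}$ exists and is an $$\left[n,\ n-p_1p_2\left\lfloor\frac{n-1}{2p_1p_2}\right\rfloor,\ \ge\left\lfloor\frac{q(n-1)}{2p_1p_2(q-1)}\right\rfloor\right]$$ code. (d) Both families are infinite: for fixed $q$, $r$ and $p_1$, as $p_2$ ranges over the primes satisfying the hypotheses, including that of (c), the length $n$ takes infinitely many values. -/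

import Mathlib

open Polynomial

/-! ### Cyclotomic cosets -/

/-- The `q`-cyclotomic coset `{i q ^ j mod N : j ≥ 0}` of `i` modulo `N`. The ring of integers
modulo `N` is represented by `{1, 2, …, N}` (so the class of `0` is represented by `N`). -/
noncomputable def cycCoset (q N i : ℕ) : Finset ℕ :=
  open Classical in {x ∈ Finset.Icc 1 N | ∃ j : ℕ, x ≡ i * q ^ j [MOD N]}

/-- `Z_{n,r} = {1 + i r : 0 ≤ i ≤ n - 1}`, inside the integers modulo `n r`. -/
def constaIndices (n r : ℕ) : Finset ℕ :=
  (Finset.range n).image fun i => 1 + i * r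

/-- `N_l`: the number of `q`-cyclotomic cosets modulo `n r` of size `l` of elements of `Z_{n,r}`. -/
noncomputable def numCosets (q n r l : ℕ) : ℕ :=
  (((constaIndices n r).image (cycCoset q (n * r))).filter fun c => c.card = l).card

/-- The coset leaders (least elements of their cosets) in `Z_{n,r}` whose cosets have size `l`. -/
noncomputable def cosetLeaders (q n r l : ℕ) : Finset ℕ :=
  open Classical in
  {x ∈ constaIndices n r |
    (∀ y ∈ cycCoset q (n * r) x, x ≤ y) ∧ (cycCoset q (n * r) x).card = l}

/-- The union of the first `k` cosets of size `l` in `Z_{n,r}`, cosets being ordered by their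
leaders: a leader is among the first `k` iff fewer than `k` leaders of that class are smaller. -/
noncomputable def firstCosets (q n r l k : ℕ) : Finset ℕ :=
  ((cosetLeaders q n r l).filter
    fun x => ((cosetLeaders q n r l).filter fun y => y < x).card < k).biUnion
      (cycCoset q (n * r))

/-- The first `⌈N_l / 2⌉` cosets of size `l` and the first `⌈N_m / 2⌉` cosets of size `m`. -/
noncomputable def ceilDefiningSet (q n r l m : ℕ) : Finset ℕ :=
  firstCosets q n r l ⌈(numCosets q n r l : ℚ) / 2⌉₊ ∪
    firstCosets q n r m ⌈(numCosets q n r m : ℚ) / 2⌉₊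

/-- The first `⌊N_l / 2⌋` cosets of size `l` and the first `⌊N_m / 2⌋` cosets of size `m`. -/
noncomputable def floorDefiningSet (q n r l m : ℕ) : Finset ℕ :=
  firstCosets q n r l ⌊(numCosets q n r l : ℚ) / 2⌋₊ ∪
    firstCosets q n r m ⌊(numCosets q n r m : ℚ) / 2⌋₊

/-! ### Constacyclic codes -/

section Codes

variable {F : Type*} [Field F] {n : ℕ}

/-- The polynomial `c₀ + c₁ x + ⋯ + c_{n-1} x ^ (n-1)` of a word. -/
noncomputable def wordPoly (c : Fin n → F) : F[X] :=
  ∑ i : Fin n, C (c i) * X ^ (i : ℕ)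

/-- The constacyclic shift `(c₀, …, c_{n-1}) ↦ (lam c_{n-1}, c₀, …, c_{n-2})`. -/
def constaShift (lam : F) (c : Fin n → F) : Fin n → F := fun i =>
  if i.val = 0 then lam * c ⟨n - 1, by have := i.isLt; omega⟩
  else c ⟨i.val - 1, by have := i.isLt; omega⟩

/-- A linear code is `lam`-constacyclic if it is closed under the constacyclic shift. -/
def IsConstacyclic (lam : F) (𝒞 : Submodule F (Fin n → F)) : Prop :=
  ∀ c ∈ 𝒞, constaShift lam c ∈ 𝒞

/-- `𝒞` is the code `⟨g⟩`, for a monic divisor `g` of `x ^ n - lam`. -/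
def IsGeneratorPoly (lam : F) (𝒞 : Submodule F (Fin n → F)) (g : F[X]) : Prop :=
  g.Monic ∧ g ∣ X ^ n - C lam ∧ ∀ c : Fin n → F, c ∈ 𝒞 ↔ g ∣ wordPoly c

/-- `𝒞` is a `lam`-constacyclic code whose defining set
`{j ∈ Z_{n,r} : g (β ^ j) = 0}` with respect to `β` is `T`, where `g` is its generator
polynomial. -/
def HasDefiningSet {K : Type*} [Field K] [Algebra F K] (lam : F) (r : ℕ) (β : K)
    (𝒞 : Submodule F (Fin n → F)) (T : Finset ℕ) : Prop :=
  IsConstacyclic lam 𝒞 ∧ ∃ g : F[X], IsGeneratorPoly lam 𝒞 g ∧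
    ∀ j : ℕ, j ∈ T ↔ j ∈ constaIndices n r ∧ aeval (β ^ j) g = 0

/-- `𝒞` is an `[n, k, ≥ d]` code: it has dimension `k`, and any two distinct codewords have Hamming
distance at least `d` (this puts no condition on the zero code). -/
def HasParameters [DecidableEq F] (𝒞 : Submodule F (Fin n → F)) (k d : ℤ) : Prop :=
  (Module.finrank F 𝒞 : ℤ) = k ∧ ∀ u ∈ 𝒞, ∀ v ∈ 𝒞, u ≠ v → d ≤ (hammingDist u v : ℤ)

end Codes

/-! ### The correction term of the distance bound -/

/-- The set `S_m` of triples `(i, j, t)`, depending on `q`, `r`, `s`, `m` and on `N = N_m`. -/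
def correctionSet (q r s m N : ℕ) : Set (ℕ × ℕ × ℕ) :=
  {(i, j, t) |
    ((m : ℝ) + 1) / 2 ≤ i ∧ (i : ℤ) ≤ ⌊(m : ℝ) - Real.logb q (s + 1)⌋ ∧
    1 ≤ j ∧ j ≤ q - 1 ∧
    (t : ℝ) < ((q : ℝ) ^ i - j * ((q : ℝ) ^ (m - i) - 1) - 1) / ((q : ℝ) ^ (m - i + 1) - q) ∧
    q ^ i + q * t + j ≡ 1 [MOD r] ∧
    ((q ^ i + q * t + j : ℕ) : ℤ) ≤
      1 + (⌈(q : ℚ) * ⌈(N : ℚ) / 2⌉ / (q - 1)⌉ - 2) * r}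

/-- `Λ_m = ⌈q |S_m| / (q - 1)⌉ - 1`. -/
noncomputable def correctionTerm (q r s m N : ℕ) : ℤ :=
  ⌈(q : ℚ) * (correctionSet q r s m N).ncard / (q - 1)⌉ - 1

/-! Everything about the cosets follows from two facts about n = Φ_m(q), m = p₁p₂. First, n ≡ Φ_m(1)
= 1 mod r, because q ≡ 1 mod r and m is not a prime power; so n and r are coprime and n is the only
multiple of n in Z_{n,r}. Second, q has order exactly m modulo every prime l dividing n. This is
standard for l ∤ m, impossible for l = p₁ because p₁ < p₂, and excluded for l = p₂ by the hypothesis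
on p₂ (`cosetSetting_of_eval_cyclotomic`). Hence every coset in Z_{n,r} except {n} has m elements,
and N_m = (n-1)/m.

By the BCH bound, a code whose defining set contains the first A elements 1 + ir of Z_{n,r} has
minimum distance greater than A. Those among them different from n lie in the first k cosets of size
m as soon as at most k of them are leaders of such cosets, so the task is to exhibit non-leaders.
Multiples of q are never leaders, since x/q lies in the coset of x; they account for ⌊A/q⌋ elements.
Each triple (i,j,t) of S_m gives another one: x = q^i + qt + j is prime to no purpose of leading its
coset, because q^{m-i}x ≡ 1 + q^{m-i}(qt + j) modulo nr and the right side is smaller than x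
(`card_leaders_le`, `exists_finset_of_correctionSet`). Solving the resulting inequality for A gives
both distance bounds. In the rounded-down code n is not in the defining set, and the condition of
(c) keeps the run of zeros below n. -/

/-- The arithmetic facts on `q`, `r`, `n`, `m` that determine the `q`-cyclotomic cosets in
`Z_{n,r}`: every one of them has size `m`, except for the coset of `n`. -/
structure CosetSetting (q r n m : ℕ) : Prop where
  two_le : 2 ≤ q
  r_dvd : r ∣ q - 1
  one_lt : 1 < n
  one_lt_size : 1 < m
  modEq_one : n ≡ 1 [MOD r]
  dvd_pow : n * r ∣ q ^ m - 1
  orderOf_eq : ∀ l : ℕ, l.Prime → l ∣ n → orderOf (q : ZMod l) = m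

/-! ### Representatives modulo N, and ranks in a finite set of naturals. -/

theorem exists_modEq_mem_Icc {N : ℕ} (hN : 0 < N) (a : ℕ) :
    ∃ x, 1 ≤ x ∧ x ≤ N ∧ x ≡ a [MOD N] := by
  by_cases h : a % N = 0
  · exact ⟨N, hN, le_rfl, by simp [Nat.ModEq, h]⟩
  · exact ⟨a % N, Nat.pos_of_ne_zero h, (Nat.mod_lt _ hN).le, Nat.mod_modEq a N⟩

theorem eq_of_modEq_of_mem_Icc {N x y : ℕ} (hx : 1 ≤ x) (hxN : x ≤ N) (hy : 1 ≤ y) (hyN : y ≤ N)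
    (h : x ≡ y [MOD N]) : x = y := by
  have h' : x - 1 ≡ y - 1 [MOD N] := by
    apply Nat.ModEq.add_right_cancel' 1
    rwa [Nat.sub_add_cancel hx, Nat.sub_add_cancel hy]
  have := Nat.ModEq.eq_of_lt_of_lt h' (by omega) (by omega)
  omega

theorem mem_cycCoset {q N i x : ℕ} :
    x ∈ cycCoset q N i ↔ (1 ≤ x ∧ x ≤ N) ∧ ∃ j : ℕ, x ≡ i * q ^ j [MOD N] := by
  simp [cycCoset]

theorem self_mem_cycCoset {q N x : ℕ} (hx : 1 ≤ x) (hxN : x ≤ N) : x ∈ cycCoset q N x :=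
  mem_cycCoset.2 ⟨⟨hx, hxN⟩, 0, by simp [Nat.ModEq.refl]⟩

theorem mem_constaIndices {n r x : ℕ} (hr : 0 < r) :
    x ∈ constaIndices n r ↔ 1 ≤ x ∧ x ≤ n * r ∧ x ≡ 1 [MOD r] := by
  simp only [constaIndices, Finset.mem_image, Finset.mem_range]
  constructor
  · rintro ⟨i, hi, rfl⟩
    refine ⟨by omega, ?_, by simp [Nat.ModEq]⟩
    have : (i + 1) * r ≤ n * r := Nat.mul_le_mul_right r hi
    rw [add_mul] at this
    omega
  · rintro ⟨h1, h2, h3⟩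
    obtain ⟨i, hi⟩ := (Nat.modEq_iff_dvd' h1).1 h3.symm
    have hx : x = 1 + i * r := by rw [mul_comm i]; omega
    refine ⟨i, ?_, hx.symm⟩
    by_contra! h
    have := Nat.mul_le_mul_right r h
    omega

theorem card_constaIndices {n r : ℕ} (hr : 0 < r) : (constaIndices n r).card = n := by
  rw [constaIndices, Finset.card_image_of_injective, Finset.card_range]
  intro i j h
  simpa [hr.ne'] using h

/-- The number of elements of a finite set of naturals that have fewer than `k` predecessors. -/
theorem card_filter_card_lt (L : Finset ℕ) {k : ℕ} (hk : k ≤ L.card) :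
    (L.filter fun x => (L.filter fun y => y < x).card < k).card = k := by
  have hmono : ∀ x ∈ L, ∀ y ∈ L, x < y →
      (L.filter fun z => z < x).card < (L.filter fun z => z < y).card := by
    intro x hx y _ hxy
    apply Finset.card_lt_card
    refine Finset.ssubset_iff_of_subset (fun z => ?_) |>.2 ⟨x, ?_, ?_⟩
    · simp only [Finset.mem_filter]; exact fun h => ⟨h.1, h.2.trans hxy⟩
    · simp [hx, hxy]
    · simp
  have hinj : Set.InjOn (fun x => (L.filter fun y => y < x).card) L := by
    intro x hx y hy h
    rcases lt_trichotomy x y with h' | h' | h'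
    · exact absurd h (hmono x hx y hy h').ne
    · exact h'
    · exact absurd h (hmono y hy x hx h').ne'
  have himg : L.image (fun x => (L.filter fun y => y < x).card) = Finset.range L.card := by
    apply Finset.eq_of_subset_of_card_le
    · intro a
      simp only [Finset.mem_image, Finset.mem_range]
      rintro ⟨x, hx, rfl⟩
      exact Finset.card_lt_card
        ((Finset.ssubset_iff_of_subset (Finset.filter_subset _ _)).2 ⟨x, hx, by simp⟩)
    · rw [Finset.card_image_of_injOn hinj, Finset.card_range]
  have h2 : (L.filter fun x => (L.filter fun y => y < x).card < k).image
      (fun x => (L.filter fun y => y < x).card) = Finset.range k := by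
    rw [← Finset.filter_image (p := fun a => a < k), himg]
    ext a
    simp only [Finset.mem_filter, Finset.mem_range]
    omega
  rw [← Finset.card_image_of_injOn (hinj.mono (Finset.coe_subset.2 (Finset.filter_subset _ _))),
    h2, Finset.card_range]

theorem mem_cosetLeaders {q n r l x : ℕ} : x ∈ cosetLeaders q n r l ↔
    x ∈ constaIndices n r ∧ (∀ y ∈ cycCoset q (n * r) x, x ≤ y) ∧
      (cycCoset q (n * r) x).card = l := by
  simp [cosetLeaders]

/-! ### Sizes, leaders and number of the cosets in Z_{n,r}. -/

namespace CosetSetting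

variable {q r n m : ℕ}

theorem r_pos (h : CosetSetting q r n m) : 0 < r := by
  have := h.two_le
  exact Nat.pos_of_dvd_of_pos h.r_dvd (by omega)

theorem modulus_pos (h : CosetSetting q r n m) : 0 < n * r :=
  Nat.mul_pos (by have := h.one_lt; omega) h.r_pos

theorem q_modEq_one (h : CosetSetting q r n m) : q ≡ 1 [MOD r] :=
  ((Nat.modEq_iff_dvd' (by have := h.two_le; omega)).2 h.r_dvd).symm

theorem pow_modEq_one (h : CosetSetting q r n m) : q ^ m ≡ 1 [MOD n * r] :=
  ((Nat.modEq_iff_dvd' (Nat.one_le_pow _ _ (by have := h.two_le; omega))).2 h.dvd_pow).symm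

theorem coprime_r (h : CosetSetting q r n m) : Nat.Coprime n r := by
  have := h.modEq_one.gcd_eq
  simpa [Nat.Coprime] using this

/-- Multiplication by q is invertible modulo nr because q^m ≡ 1: the power q^{(m-1)j} undoes q^j, so
lying in the same coset is symmetric. -/
theorem cycCoset_eq_of_mem (h : CosetSetting q r n m) {x y : ℕ}
    (hy : y ∈ cycCoset q (n * r) x) : cycCoset q (n * r) y = cycCoset q (n * r) x := by
  obtain ⟨-, j, hj⟩ := mem_cycCoset.1 hy
  have hj' : x ≡ y * q ^ ((m - 1) * j) [MOD n * r] := by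
    have h1 : y * q ^ ((m - 1) * j) ≡ x * q ^ j * q ^ ((m - 1) * j) [MOD n * r] := hj.mul_right _
    have h2 : x * q ^ j * q ^ ((m - 1) * j) = x * (q ^ m) ^ j := by
      rw [mul_assoc, ← pow_add, ← pow_mul]
      congr 2
      obtain ⟨k, rfl⟩ : ∃ k, m = k + 1 := ⟨m - 1, by have := h.one_lt_size; omega⟩
      rw [Nat.add_sub_cancel]; ring
    have h3 : x * (q ^ m) ^ j ≡ x * 1 ^ j [MOD n * r] := (h.pow_modEq_one.pow j).mul_left x
    rw [h2] at h1
    simpa using (h1.trans h3).symm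
  ext z
  simp only [mem_cycCoset]
  refine and_congr_right fun _ => ⟨?_, ?_⟩
  · rintro ⟨k, hk⟩
    refine ⟨j + k, hk.trans ?_⟩
    rw [pow_add, ← mul_assoc]
    exact hj.mul_right _
  · rintro ⟨k, hk⟩
    refine ⟨(m - 1) * j + k, hk.trans ?_⟩
    rw [pow_add, ← mul_assoc]
    exact hj'.mul_right _

theorem mem_iff (h : CosetSetting q r n m) {x : ℕ} :
    x ∈ constaIndices n r ↔ 1 ≤ x ∧ x ≤ n * r ∧ x ≡ 1 [MOD r] :=
  mem_constaIndices h.r_pos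

theorem self_mem (h : CosetSetting q r n m) {x : ℕ} (hx : x ∈ constaIndices n r) :
    x ∈ cycCoset q (n * r) x :=
  self_mem_cycCoset (h.mem_iff.1 hx).1 (h.mem_iff.1 hx).2.1

theorem cycCoset_subset (h : CosetSetting q r n m) {x : ℕ} (hx : x ∈ constaIndices n r) :
    cycCoset q (n * r) x ⊆ constaIndices n r := by
  intro y hy
  obtain ⟨⟨h1, h2⟩, j, hj⟩ := mem_cycCoset.1 hy
  refine h.mem_iff.2 ⟨h1, h2, ?_⟩
  have h3 : y ≡ x * q ^ j [MOD r] := hj.of_mul_left n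
  have h4 : x * q ^ j ≡ 1 * 1 ^ j [MOD r] := (h.mem_iff.1 hx).2.2.mul (h.q_modEq_one.pow j)
  simpa using h3.trans h4

theorem n_mem (h : CosetSetting q r n m) : n ∈ constaIndices n r :=
  h.mem_iff.2 ⟨h.one_lt.le, Nat.le_mul_of_pos_right _ h.r_pos, h.modEq_one⟩

/-- Both x and n are 0 modulo n and 1 modulo r, so they agree modulo nr by the Chinese remainder
theorem. -/
theorem eq_n_of_dvd (h : CosetSetting q r n m) {x : ℕ} (hx : x ∈ constaIndices n r)
    (hn : n ∣ x) : x = n := by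
  obtain ⟨h1, h2, h3⟩ := h.mem_iff.1 hx
  have h4 : x ≡ n [MOD n * r] := by
    rw [← Nat.modEq_and_modEq_iff_modEq_mul h.coprime_r]
    exact ⟨((Nat.modEq_zero_iff_dvd).2 hn).trans ((Nat.modEq_zero_iff_dvd).2 dvd_rfl).symm,
      h3.trans h.modEq_one.symm⟩
  exact eq_of_modEq_of_mem_Icc h1 h2 h.one_lt.le (Nat.le_mul_of_pos_right _ h.r_pos) h4

theorem cycCoset_n (h : CosetSetting q r n m) : cycCoset q (n * r) n = {n} := by
  ext y
  rw [Finset.mem_singleton]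
  constructor
  · intro hy
    apply h.eq_n_of_dvd (h.cycCoset_subset h.n_mem hy)
    obtain ⟨-, j, hj⟩ := mem_cycCoset.1 hy
    have h3 : y ≡ n * q ^ j [MOD n] := hj.of_mul_right r
    exact (Nat.modEq_zero_iff_dvd).1
      (h3.trans ((Nat.modEq_zero_iff_dvd).2 (dvd_mul_right n _)))
  · rintro rfl
    exact h.self_mem h.n_mem

/-- A coincidence x q^j ≡ x q^k modulo n can be divided by x to give q^j ≡ q^k modulo n / gcd(n, x),
which is not 1. A prime factor of that quotient divides n, so q has order m modulo it and j = k when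
both are below m. -/
theorem card_cycCoset_of_not_dvd (h : CosetSetting q r n m) {x : ℕ} (hn : ¬ n ∣ x) :
    (cycCoset q (n * r) x).card = m := by
  choose f hf1 hf2 hf3 using fun j : ℕ => exists_modEq_mem_Icc h.modulus_pos (x * q ^ j)
  have himg : (Finset.range m).image f = cycCoset q (n * r) x := by
    ext y
    simp only [Finset.mem_image, Finset.mem_range, mem_cycCoset]
    constructor
    · rintro ⟨j, -, rfl⟩
      exact ⟨⟨hf1 j, hf2 j⟩, j, hf3 j⟩
    · rintro ⟨⟨h1, h2⟩, j, hj⟩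
      refine ⟨j % m, Nat.mod_lt _ (by have := h.one_lt_size; omega), ?_⟩
      apply eq_of_modEq_of_mem_Icc (hf1 _) (hf2 _) h1 h2
      refine (hf3 _).trans (Nat.ModEq.trans ?_ hj.symm)
      apply Nat.ModEq.mul_left
      conv_rhs => rw [← Nat.mod_add_div j m, pow_add, pow_mul]
      simpa using ((h.pow_modEq_one.pow (j / m)).mul_left (q ^ (j % m))).symm
  have hinj : Set.InjOn f (Finset.range m : Set ℕ) := by
    have key : ∀ j k : ℕ, k < m → j ≤ k → f j = f k → j = k := by
      intro j k hk hjk hfe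
      by_contra hne
      have h1 : x * q ^ j ≡ x * q ^ k [MOD n] := by
        have := (hf3 j).symm.trans (hfe ▸ hf3 k)
        exact this.of_mul_right r
      set g := Nat.gcd n x with hg
      have hgpos : 0 < g := Nat.gcd_pos_of_pos_left _ (by have := h.one_lt; omega)
      have hgn : g ∣ n := Nat.gcd_dvd_left _ _
      have h2 : q ^ j ≡ q ^ k [MOD n / g] :=
        Nat.ModEq.cancel_left_div_gcd (by have := h.one_lt; omega) h1
      have h3 : n / g ≠ 1 := by
        intro h4
        apply hn
        have : n = g := by
          have := Nat.div_mul_cancel hgn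
          rw [h4, one_mul] at this
          exact this.symm
        rw [this]
        exact Nat.gcd_dvd_right _ _
      obtain ⟨l, hl, hln⟩ := Nat.exists_prime_and_dvd h3
      have hln' : l ∣ n := hln.trans (Nat.div_dvd_of_dvd hgn)
      have : Fact l.Prime := ⟨hl⟩
      have h4 : (q : ZMod l) ^ j = (q : ZMod l) ^ k := by
        have := (ZMod.natCast_eq_natCast_iff _ _ _).2 (h2.of_dvd hln)
        simpa using this
      have hord := h.orderOf_eq l hl hln'
      have h0 : (q : ZMod l) ≠ 0 := by
        intro h0
        have := h.one_lt_size
        have h6 := pow_orderOf_eq_one (q : ZMod l)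
        rw [hord, h0, zero_pow (by omega)] at h6
        exact zero_ne_one h6
      have h5 := (pow_inj_mod (x := Units.mk0 (q : ZMod l) h0) (n := j) (m := k)).1
        (by ext; simpa using h4)
      rw [← orderOf_units, Units.val_mk0, hord, Nat.mod_eq_of_lt hk,
        Nat.mod_eq_of_lt (by omega)] at h5
      exact hne h5
    intro j hj k hk hfe
    simp only [Finset.coe_range, Set.mem_Iio] at hj hk
    rcases le_total j k with hjk | hjk
    · exact key j k hk hjk hfe
    · exact (key k j hj hjk hfe.symm).symm
  rw [← himg, Finset.card_image_of_injOn hinj, Finset.card_range]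

theorem card_cycCoset (h : CosetSetting q r n m) {x : ℕ} (hx : x ∈ constaIndices n r) :
    (cycCoset q (n * r) x).card = if x = n then 1 else m := by
  split_ifs with hxn
  · rw [hxn, h.cycCoset_n, Finset.card_singleton]
  · exact h.card_cycCoset_of_not_dvd fun hd => hxn (h.eq_n_of_dvd hx hd)

theorem image_card_cycCoset (h : CosetSetting q r n m) :
    ((constaIndices n r).image fun i => (cycCoset q (n * r) i).card) = {1, m} := by
  have h1 : 1 ∈ constaIndices n r :=
    h.mem_iff.2 ⟨le_rfl, h.modulus_pos, Nat.ModEq.refl _⟩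
  ext l
  simp only [Finset.mem_image, Finset.mem_insert, Finset.mem_singleton]
  constructor
  · rintro ⟨x, hx, rfl⟩
    rw [h.card_cycCoset hx]
    split_ifs <;> simp
  · rintro (rfl | rfl)
    · exact ⟨n, h.n_mem, by simp [h.card_cycCoset h.n_mem]⟩
    · exact ⟨1, h1, by rw [h.card_cycCoset h1, if_neg h.one_lt.ne]⟩

/-- Every coset has a leader. -/
theorem exists_leader (h : CosetSetting q r n m) {x : ℕ} (hx : x ∈ constaIndices n r) :
    ∃ y ∈ cosetLeaders q n r (cycCoset q (n * r) x).card,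
      y ≤ x ∧ cycCoset q (n * r) y = cycCoset q (n * r) x := by
  obtain ⟨y, hy, hmin⟩ := Finset.exists_min_image (cycCoset q (n * r) x) id ⟨x, h.self_mem hx⟩
  have he := h.cycCoset_eq_of_mem hy
  exact ⟨y, mem_cosetLeaders.2 ⟨h.cycCoset_subset hx hy, by rw [he]; exact hmin, by rw [he]⟩,
    hmin x (h.self_mem hx), he⟩

theorem leader_unique (h : CosetSetting q r n m) {l l' x y z : ℕ}
    (hx : x ∈ cosetLeaders q n r l) (hy : y ∈ cosetLeaders q n r l')
    (hzx : z ∈ cycCoset q (n * r) x) (hzy : z ∈ cycCoset q (n * r) y) : x = y := by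
  have he : cycCoset q (n * r) x = cycCoset q (n * r) y :=
    (h.cycCoset_eq_of_mem hzx).symm.trans (h.cycCoset_eq_of_mem hzy)
  rw [mem_cosetLeaders] at hx hy
  exact le_antisymm (hx.2.1 y (he ▸ h.self_mem hy.1)) (hy.2.1 x (he ▸ h.self_mem hx.1))

/-- Taking the coset of a leader is a bijection, so cosets can be counted by their leaders. -/
theorem numCosets_eq (h : CosetSetting q r n m) (l : ℕ) :
    numCosets q n r l = (cosetLeaders q n r l).card := by
  have himg : ((constaIndices n r).image (cycCoset q (n * r))).filter (fun c => c.card = l) =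
      (cosetLeaders q n r l).image (cycCoset q (n * r)) := by
    ext c
    simp only [Finset.mem_filter, Finset.mem_image]
    constructor
    · rintro ⟨⟨x, hx, rfl⟩, rfl⟩
      obtain ⟨y, hy, -, he⟩ := h.exists_leader hx
      exact ⟨y, hy, he⟩
    · rintro ⟨x, hx, rfl⟩
      rw [mem_cosetLeaders] at hx
      exact ⟨⟨x, hx.1, rfl⟩, hx.2.2⟩
  rw [numCosets, himg, Finset.card_image_of_injOn]
  intro x hx y hy he
  have hx' := (mem_cosetLeaders.1 hx).1
  exact h.leader_unique hx hy (h.self_mem hx') (he ▸ h.self_mem hx')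

theorem cosetLeaders_one (h : CosetSetting q r n m) : cosetLeaders q n r 1 = {n} := by
  ext x
  rw [mem_cosetLeaders, Finset.mem_singleton]
  constructor
  · rintro ⟨hx, -, hc⟩
    by_contra hne
    rw [h.card_cycCoset hx, if_neg hne] at hc
    exact h.one_lt_size.ne' hc
  · rintro rfl
    refine ⟨h.n_mem, ?_, ?_⟩ <;> simp [h.cycCoset_n]

theorem numCosets_one (h : CosetSetting q r n m) : numCosets q n r 1 = 1 := by
  rw [h.numCosets_eq, h.cosetLeaders_one, Finset.card_singleton]

theorem card_biUnion_leaders (h : CosetSetting q r n m) {l : ℕ} {L : Finset ℕ}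
    (hL : L ⊆ cosetLeaders q n r l) : (L.biUnion (cycCoset q (n * r))).card = L.card * l := by
  rw [Finset.card_biUnion, Finset.sum_congr rfl fun x hx => (mem_cosetLeaders.1 (hL hx)).2.2,
    Finset.sum_const, smul_eq_mul]
  intro x hx y hy hxy
  rw [Function.onFun, Finset.disjoint_left]
  exact fun z hzx hzy => hxy (h.leader_unique (hL hx) (hL hy) hzx hzy)

theorem card_firstCosets (h : CosetSetting q r n m) {l k : ℕ} (hk : k ≤ numCosets q n r l) :
    (firstCosets q n r l k).card = k * l := by
  rw [firstCosets, h.card_biUnion_leaders (Finset.filter_subset _ _),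
    card_filter_card_lt _ (h.numCosets_eq l ▸ hk)]

theorem firstCosets_subset (h : CosetSetting q r n m) {l k : ℕ} :
    firstCosets q n r l k ⊆ constaIndices n r := by
  refine Finset.biUnion_subset.2 fun x hx => h.cycCoset_subset ?_
  exact (mem_cosetLeaders.1 (Finset.filter_subset _ _ hx)).1

theorem cycCoset_subset_firstCosets (h : CosetSetting q r n m) {l k x : ℕ}
    (hx : x ∈ firstCosets q n r l k) : cycCoset q (n * r) x ⊆ firstCosets q n r l k := by
  simp only [firstCosets, Finset.mem_biUnion] at hx
  obtain ⟨y, hy, hxy⟩ := hx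
  rw [h.cycCoset_eq_of_mem hxy]
  exact Finset.subset_biUnion_of_mem _ hy

theorem card_cycCoset_of_mem_firstCosets (h : CosetSetting q r n m) {l k x : ℕ}
    (hx : x ∈ firstCosets q n r l k) : (cycCoset q (n * r) x).card = l := by
  simp only [firstCosets, Finset.mem_biUnion] at hx
  obtain ⟨y, hy, hxy⟩ := hx
  rw [h.cycCoset_eq_of_mem hxy]
  exact (mem_cosetLeaders.1 (Finset.filter_subset _ _ hy)).2.2

/-- An element of a coset of size `l` is in the union of the first `k` such cosets if at most `k`
leaders do not exceed it. -/
theorem mem_firstCosets (h : CosetSetting q r n m) {l k x : ℕ} (hx : x ∈ constaIndices n r)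
    (hl : (cycCoset q (n * r) x).card = l)
    (hk : ((cosetLeaders q n r l).filter fun y => y ≤ x).card ≤ k) :
    x ∈ firstCosets q n r l k := by
  obtain ⟨y, hy, hyx, he⟩ := h.exists_leader hx
  rw [hl] at hy
  refine Finset.mem_biUnion.2 ⟨y, Finset.mem_filter.2 ⟨hy, ?_⟩, he ▸ h.self_mem hx⟩
  -- The leader `y` of `x` is counted among the leaders not exceeding `x` but not among those below
  -- `y`; this gives the strict inequality.
  refine lt_of_lt_of_le (Finset.card_lt_card ?_) hk
  refine (Finset.ssubset_iff_of_subset fun z => ?_).2 ⟨y, ?_, ?_⟩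
  · simp only [Finset.mem_filter]
    exact fun hz => ⟨hz.1, by omega⟩
  · simp [hy, hyx]
  · simp

/-- The cosets of size m partition Z_{n,r} with n removed. -/
theorem numCosets_mul (h : CosetSetting q r n m) : numCosets q n r m * m + 1 = n := by
  have hdisj : (constaIndices n r).erase n = (cosetLeaders q n r m).biUnion
      (cycCoset q (n * r)) := by
    ext x
    simp only [Finset.mem_erase, Finset.mem_biUnion]
    constructor
    · rintro ⟨hne, hx⟩
      obtain ⟨y, hy, -, he⟩ := h.exists_leader hx
      rw [h.card_cycCoset hx, if_neg hne] at hy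
      exact ⟨y, hy, he ▸ h.self_mem hx⟩
    · rintro ⟨y, hy, hxy⟩
      have hx := h.cycCoset_subset (mem_cosetLeaders.1 hy).1 hxy
      refine ⟨?_, hx⟩
      rintro rfl
      have := (mem_cosetLeaders.1 hy).2.2
      rw [← h.cycCoset_eq_of_mem hxy, h.cycCoset_n, Finset.card_singleton] at this
      exact h.one_lt_size.ne this
  rw [h.numCosets_eq, ← h.card_biUnion_leaders Finset.Subset.rfl, ← hdisj,
    Finset.card_erase_add_one h.n_mem, card_constaIndices h.r_pos]

theorem numCosets_pos (h : CosetSetting q r n m) : 0 < numCosets q n r m := by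
  have h1 := h.numCosets_mul
  have h2 := h.one_lt
  by_contra h3
  obtain h4 : numCosets q n r m = 0 := by omega
  rw [h4] at h1
  omega

/-! ### Elements that are not leaders. -/

/-- A leader of a coset of size `m` is not divisible by `q`. -/
theorem not_dvd_of_mem_cosetLeaders (h : CosetSetting q r n m) {l x : ℕ}
    (hx : x ∈ cosetLeaders q n r l) : ¬ q ∣ x := by
  rintro ⟨y, rfl⟩
  obtain ⟨hZ, hmin, -⟩ := mem_cosetLeaders.1 hx
  obtain ⟨h1, h2, -⟩ := h.mem_iff.1 hZ
  have hq := h.two_le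
  have hy : 1 ≤ y := by
    by_contra h0
    obtain rfl : y = 0 := by omega
    simp at h1
  have hylt : y < q * y := by nlinarith
  -- Since qy · q^{m-1} = y q^m ≡ y, the coset of qy contains the smaller element y.
  have : y ∈ cycCoset q (n * r) (q * y) := by
    refine mem_cycCoset.2 ⟨⟨hy, by omega⟩, m - 1, ?_⟩
    have h3 : q * y * q ^ (m - 1) = y * q ^ m := by
      obtain ⟨k, rfl⟩ : ∃ k, m = k + 1 := ⟨m - 1, by have := h.one_lt_size; omega⟩
      rw [Nat.add_sub_cancel]; ring
    rw [h3]
    simpa using (h.pow_modEq_one.mul_left y).symm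
  exact absurd (hmin y this) (by omega)

/-- Among the first `A` elements of `Z_{n,r}` at least `A / q` are divisible by `q`, hence are not
leaders; `S` is a further set of elements that are not leaders. -/
theorem card_leaders_le (h : CosetSetting q r n m) {A : ℕ} (S : Finset ℕ)
    (hS : ∀ x ∈ S, ¬ q ∣ x ∧ x ∉ cosetLeaders q n r m ∧ ∃ i < A, x = 1 + i * r) :
    ((cosetLeaders q n r m).filter fun x => x < 1 + A * r).card + S.card + A / q ≤ A := by
  have hr := h.r_pos
  have hq := h.two_le
  set L := (cosetLeaders q n r m).filter fun x => x < 1 + A * r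
  -- These elements are q(1 + kr): the index (q-1)/r + kq is chosen so that 1 + (q-1) = q. It lies
  -- below (k+1)q ≤ A.
  set Q := (Finset.range (A / q)).image fun k => 1 + ((q - 1) / r + k * q) * r
  set E := (Finset.range A).image fun i => 1 + i * r
  have hmulr : (q - 1) / r * r = q - 1 := Nat.div_mul_cancel h.r_dvd
  have hQc : Q.card = A / q := by
    rw [Finset.card_image_of_injective, Finset.card_range]
    intro i j hij
    have hq0 : q ≠ 0 := by omega
    simpa [hr.ne', hq0] using hij
  have hEc : E.card ≤ A := Finset.card_image_le.trans (Finset.card_range A).le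
  have hQd : ∀ x ∈ Q, q ∣ x := by
    intro x hx
    obtain ⟨k, -, rfl⟩ := Finset.mem_image.1 hx
    refine ⟨1 + k * r, ?_⟩
    rw [add_mul, hmulr, mul_add, mul_one, mul_assoc]
    have : q * (k * r) = k * (q * r) := by ring
    omega
  have hLS : Disjoint L S := by
    rw [Finset.disjoint_left]
    exact fun x hx hxS => (hS x hxS).2.1 (Finset.filter_subset _ _ hx)
  have hLSQ : Disjoint (L ∪ S) Q := by
    rw [Finset.disjoint_left]
    intro x hx hxQ
    rcases Finset.mem_union.1 hx with hx | hx
    · exact h.not_dvd_of_mem_cosetLeaders (Finset.filter_subset _ _ hx) (hQd x hxQ)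
    · exact (hS x hx).1 (hQd x hxQ)
  have hsub : (L ∪ S) ∪ Q ⊆ E := by
    intro x hx
    rw [Finset.mem_image]
    simp only [Finset.mem_range]
    rcases Finset.mem_union.1 hx with hx | hx
    · rcases Finset.mem_union.1 hx with hx | hx
      · obtain ⟨hx, hlt⟩ := Finset.mem_filter.1 hx
        obtain ⟨i, -, rfl⟩ := Finset.mem_image.1 (mem_cosetLeaders.1 hx).1
        refine ⟨i, ?_, rfl⟩
        by_contra! hi
        have := Nat.mul_le_mul_right r hi
        omega
      · obtain ⟨i, hi, rfl⟩ := (hS x hx).2.2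
        exact ⟨i, hi, rfl⟩
    · obtain ⟨k, hk, rfl⟩ := Finset.mem_image.1 hx
      refine ⟨_, ?_, rfl⟩
      rw [Finset.mem_range] at hk
      have h1 : (k + 1) * q ≤ A :=
        (Nat.mul_le_mul_right q hk).trans (Nat.div_mul_le_self A q)
      have h2 : (q - 1) / r ≤ q - 1 := Nat.div_le_self _ _
      rw [add_mul] at h1
      omega
  have := (Finset.card_le_card hsub).trans hEc
  rwa [Finset.card_union_of_disjoint hLSQ, Finset.card_union_of_disjoint hLS, hQc] at this

/-- The triples of the correction set give elements of `Z_{n,r}` that are neither leaders nor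
divisible by `q`. -/
theorem exists_finset_of_correctionSet (h : CosetSetting q r n m) {s N B : ℕ} (hs : 0 < s)
    (hB : ⌈(q : ℚ) * ⌈(N : ℚ) / 2⌉ / (q - 1)⌉ - 1 ≤ (B : ℤ)) :
    ∃ S : Finset ℕ, S.card = (correctionSet q r s m N).ncard ∧
      ∀ x ∈ S, ¬ q ∣ x ∧ x ∉ cosetLeaders q n r m ∧ ∃ i < B, x = 1 + i * r := by
  have hq := h.two_le
  have hr := h.r_pos
  set f : ℕ × ℕ × ℕ → ℕ := fun a => q ^ a.1 + q * a.2.2 + a.2.1 with hf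
  -- the description of the elements of the correction set in terms of natural numbers
  have key : ∀ i j t : ℕ, (i, j, t) ∈ correctionSet q r s m N →
      i < m ∧ 1 ≤ j ∧ j < q ∧ q ^ i + q * t + j < 2 * q ^ i ∧
      1 + q ^ (m - i + 1) * t + j * q ^ (m - i) < q ^ i + q * t + j ∧
      ∃ k < B, q ^ i + q * t + j = 1 + k * r := by
    rintro i j t ⟨h1, h2, h3, h4, h5, h6, h7⟩
    have hqR : (2 : ℝ) ≤ q := by exact_mod_cast hq
    -- As s > 0, the logarithm is positive, so i < m strictly. This makes the denominator in the
    -- bound on t positive.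
    have him : i < m := by
      have h8 : 0 < Real.logb q (s + 1) :=
        Real.logb_pos (by linarith) (by have : (0 : ℝ) < s := by exact_mod_cast hs
                                        linarith)
      have h9 : (i : ℝ) ≤ (m : ℝ) - Real.logb q (s + 1) := by
        have := Int.le_floor.1 h2
        exact_mod_cast this
      have : (i : ℝ) < m := by linarith
      exact_mod_cast this
    have hpow : (q : ℝ) ^ 1 ≤ q ^ (m - i) := pow_le_pow_right₀ (by linarith) (by omega)
    rw [pow_one] at hpow
    have h10 : (0 : ℝ) < (q : ℝ) ^ (m - i + 1) - q := by
      rw [pow_succ]; nlinarith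
    -- Cleared of its denominator, the bound on t reads (qt + j)(q^{m-i} - 1) < q^i - 1. It yields
    -- both qt + j < q^i and 1 + q^{m-i}(qt + j) < q^i + qt + j.
    rw [lt_div_iff₀ h10] at h5
    have hqi : (1 : ℝ) ≤ (q : ℝ) ^ i := one_le_pow₀ (by linarith)
    refine ⟨him, h3, by omega, ?_, ?_, ?_⟩
    · have h11 : (q : ℝ) ^ i + q * t + j < 2 * q ^ i := by
        have h12 : ((q : ℝ) * t + j) * (q ^ (m - i) - 1) < q ^ i - 1 := by
          rw [pow_succ] at h5
          nlinarith
        have h13 : (0 : ℝ) ≤ (q : ℝ) * t + j := by positivity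
        nlinarith
      exact_mod_cast h11
    · have h11 : 1 + (q : ℝ) ^ (m - i + 1) * t + j * q ^ (m - i) < q ^ i + q * t + j := by
        nlinarith
      exact_mod_cast h11
    · have hge : 1 ≤ q ^ i + q * t + j := by omega
      obtain ⟨k, hk⟩ := (Nat.modEq_iff_dvd' hge).1 h6.symm
      refine ⟨k, ?_, by rw [mul_comm k]; omega⟩
      have h8 : q ^ i + q * t + j = 1 + r * k := by omega
      rw [h8] at h7
      push_cast at h7
      have h9 : (r : ℤ) * k ≤ (B - 1) * r :=
        (by linarith : (r : ℤ) * k ≤ (⌈(q : ℚ) * ⌈(N : ℚ) / 2⌉ / (q - 1)⌉ - 2) * r).trans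
          (mul_le_mul_of_nonneg_right (by linarith) (by positivity))
      have h10 : (k : ℤ) ≤ B - 1 := by
        have : (0 : ℤ) < r := by exact_mod_cast hr
        nlinarith
      omega
  -- The value lies in [q^i, 2q^i), which determines i since q ≥ 2; then j is a residue modulo q,
  -- and t is what remains.
  have hinj : Set.InjOn f (correctionSet q r s m N) := by
    rintro ⟨i, j, t⟩ hx ⟨i', j', t'⟩ hx' hff
    obtain ⟨-, -, hj, hlt, -, -⟩ := key i j t hx
    obtain ⟨-, -, hj', hlt', -, -⟩ := key i' j' t' hx'
    simp only [hf] at hff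
    have haux : ∀ a b : ℕ, a < b → 2 * q ^ a ≤ q ^ b := fun a b hab =>
      calc 2 * q ^ a ≤ q * q ^ a := Nat.mul_le_mul_right _ hq
        _ = q ^ (a + 1) := by ring
        _ ≤ q ^ b := Nat.pow_le_pow_right (by omega) hab
    have hi : i = i' := by
      rcases lt_trichotomy i i' with h' | h' | h'
      · have := haux _ _ h'; omega
      · exact h'
      · have := haux _ _ h'; omega
    subst hi
    have hff' : j + q * t = j' + q * t' := by omega
    have hjj : j = j' := by
      have := congrArg (· % q) hff'
      simpa [Nat.mod_eq_of_lt hj, Nat.mod_eq_of_lt hj'] using this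
    subst hjj
    have : q * t = q * t' := by omega
    have := Nat.eq_of_mul_eq_mul_left (by omega) this
    rw [this]
  have hsub : f '' correctionSet q r s m N ⊆ (Finset.range (1 + B * r) : Set ℕ) := by
    rintro _ ⟨⟨i, j, t⟩, hx, rfl⟩
    obtain ⟨-, -, -, -, -, k, hk, he⟩ := key i j t hx
    simp only [hf, he, Finset.coe_range, Set.mem_Iio]
    have := Nat.mul_lt_mul_of_pos_right hk hr
    omega
  have hfin : (f '' correctionSet q r s m N).Finite := (Finset.finite_toSet _).subset hsub
  refine ⟨hfin.toFinset, ?_, ?_⟩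
  · rw [← Set.ncard_eq_toFinset_card _ hfin, hinj.ncard_image]
  · intro x hx
    rw [Set.Finite.mem_toFinset] at hx
    obtain ⟨⟨i, j, t⟩, hx, rfl⟩ := hx
    obtain ⟨him, hj1, hjq, hlt, hless, k, hk, he⟩ := key i j t hx
    simp only [hf]
    refine ⟨?_, ?_, k, hk, he⟩
    · intro hd
      have hi : i ≠ 0 := by
        rintro rfl
        simp only [pow_zero] at hlt
        have : 1 ≤ q ^ (m - 0) := Nat.one_le_pow _ _ (by omega)
        omega
      have h1 : q ∣ q ^ i + q * t := Dvd.dvd.add (dvd_pow_self q hi) (dvd_mul_right q t)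
      have h2 := (Nat.dvd_add_right h1).1 hd
      exact absurd (Nat.le_of_dvd hj1 h2) (by omega)
    · intro hL
      have hx := mem_cosetLeaders.1 hL
      -- Multiplication by q^{m-i} turns q^i into q^m ≡ 1, which produces this smaller element of
      -- the same coset.
      refine absurd (hx.2.1 (1 + q ^ (m - i + 1) * t + j * q ^ (m - i)) ?_) (by omega)
      have hle := (h.mem_iff.1 hx.1).2.1
      refine mem_cycCoset.2 ⟨⟨by omega, by omega⟩, m - i, ?_⟩
      have h1 : (q ^ i + q * t + j) * q ^ (m - i) =
          q ^ m + (q ^ (m - i + 1) * t + j * q ^ (m - i)) := by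
        have : q ^ m = q ^ i * q ^ (m - i) := by rw [← pow_add]; congr 1; omega
        rw [this]; ring
      rw [h1, add_assoc]
      exact (h.pow_modEq_one.add_right _).symm

end CosetSetting

/-- Powers of a nonzero element of a field agree iff the exponents agree modulo its order. -/
theorem field_pow_eq_pow_iff_modEq {K : Type*} [Field K] {x : K} (hx : x ≠ 0) {a b : ℕ} :
    x ^ a = x ^ b ↔ a ≡ b [MOD orderOf x] := by
  have h := pow_eq_pow_iff_modEq (x := Units.mk0 x hx) (n := a) (m := b)
  rwa [← orderOf_units, Units.ext_iff, Units.val_pow_eq_pow_val, Units.val_pow_eq_pow_val,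
    Units.val_mk0] at h

/-! ### Descent of polynomials to the finite base field. -/

section Descent

variable {F K : Type*} [Field F] [Fintype F] [Field K] [Algebra F K]

/-- An element of an extension of a finite field that is fixed by the Frobenius is in the base. -/
theorem mem_range_algebraMap_of_pow_card_eq {x : K} (hx : x ^ Fintype.card F = x) :
    x ∈ Set.range (algebraMap F K) := by
  classical
  by_contra hne
  have h1 : (X ^ Fintype.card F - X : K[X]) ≠ 0 :=
    FiniteField.X_pow_card_sub_X_ne_zero K Fintype.one_lt_card
  -- Otherwise X^q - X, with q = |F|, would have q + 1 roots.
  have h2 : insert x (Finset.univ.image (algebraMap F K)) ⊆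
      (X ^ Fintype.card F - X : K[X]).roots.toFinset := by
    intro y hy
    rw [Multiset.mem_toFinset, mem_roots h1, IsRoot.def, eval_sub, eval_pow, eval_X, sub_eq_zero]
    rcases Finset.mem_insert.1 hy with rfl | hy
    · exact hx
    · obtain ⟨a, -, rfl⟩ := Finset.mem_image.1 hy
      rw [← map_pow, FiniteField.pow_card]
  have h3 := (Finset.card_le_card h2).trans (Multiset.toFinset_card_le _)
  rw [Finset.card_insert_of_notMem (by simpa using hne),
    Finset.card_image_of_injective _ (algebraMap F K).injective, Finset.card_univ] at h3
  have h4 := h3.trans (card_roots' _)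
  rw [FiniteField.X_pow_card_sub_X_natDegree_eq K Fintype.one_lt_card] at h4
  omega

/-- A monic polynomial with simple roots whose set of roots is stable under the Frobenius is defined
over the base field. -/
theorem exists_map_eq_prod_X_sub_C (R : Finset K) (hR : ∀ x ∈ R, x ^ Fintype.card F ∈ R) :
    ∃ g : F[X], g.Monic ∧ g.map (algebraMap F K) = ∏ x ∈ R, (X - C x) := by
  classical
  set φ : K →+* K := (FiniteField.frobeniusAlgHom F K).toRingHom with hφ
  have hφx : ∀ x, φ x = x ^ Fintype.card F := fun x => rfl
  -- The Frobenius is injective, so it permutes the finite set R. It therefore fixes the product,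
  -- and with it every coefficient.
  have himg : R.image φ = R := by
    apply Finset.eq_of_subset_of_card_le
    · intro y hy
      obtain ⟨x, hx, rfl⟩ := Finset.mem_image.1 hy
      exact hR x hx
    · rw [Finset.card_image_of_injective _ φ.injective]
  have hmap : (∏ x ∈ R, (X - C x)).map φ = ∏ x ∈ R, (X - C x) := by
    rw [Polynomial.map_prod]
    conv_rhs => rw [← himg, Finset.prod_image fun x _ y _ h => φ.injective h]
    simp
  have hlift : (∏ x ∈ R, (X - C x)) ∈ lifts (algebraMap F K) := by
    rw [lifts_iff_coeff_lifts]
    intro i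
    apply mem_range_algebraMap_of_pow_card_eq
    conv_rhs => rw [← hmap]
    rw [coeff_map, hφx]
  obtain ⟨g, hg, -, hm⟩ := lifts_and_natDegree_eq_and_monic hlift
    (monic_prod_of_monic _ _ fun x _ => monic_X_sub_C x)
  exact ⟨g, hm, hg⟩

end Descent

/-! ### Polynomial codes, their dimension, and the BCH bound. -/

section Codes

variable {F : Type*} [Field F] {n : ℕ}

theorem wordPoly_eq_degreeLTEquiv_symm (c : Fin n → F) :
    wordPoly c = ((degreeLTEquiv F n).symm c : F[X]) := by
  simp [wordPoly, degreeLTEquiv, C_mul_X_pow_eq_monomial]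

theorem degree_wordPoly_lt (c : Fin n → F) : (wordPoly c).degree < n := by
  rw [wordPoly_eq_degreeLTEquiv_symm]
  exact mem_degreeLT.1 (Subtype.prop _)

theorem coeff_wordPoly (c : Fin n → F) (i : Fin n) : (wordPoly c).coeff i = c i := by
  rw [wordPoly_eq_degreeLTEquiv_symm]
  exact congrFun ((degreeLTEquiv F n).apply_symm_apply c) i

/-- The linear code of the words whose polynomial is a multiple of `g`. -/
noncomputable def codeOfPoly (n : ℕ) (g : F[X]) : Submodule F (Fin n → F) :=
  ((Ideal.span {g}).restrictScalars F).comap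
    ((degreeLT F n).subtype ∘ₗ (degreeLTEquiv F n).symm.toLinearMap)

theorem mem_codeOfPoly {g : F[X]} {c : Fin n → F} : c ∈ codeOfPoly n g ↔ g ∣ wordPoly c := by
  rw [wordPoly_eq_degreeLTEquiv_symm]
  exact Ideal.mem_span_singleton

/-- The shift is multiplication by x modulo x^n - λ; the subtracted term trades the overflow c_{n-1}
x^n for λ c_{n-1}. -/
theorem wordPoly_constaShift (hn : 0 < n) (lam : F) (c : Fin n → F) :
    wordPoly (constaShift lam c) =
      X * wordPoly c - C (c ⟨n - 1, by omega⟩) * (X ^ n - C lam) := by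
  obtain ⟨k, rfl⟩ : ∃ k, n = k + 1 := ⟨n - 1, by omega⟩
  simp only [wordPoly]
  rw [Fin.sum_univ_succ, Fin.sum_univ_castSucc (f := fun i => C (c i) * X ^ (i : ℕ))]
  have h1 : ∀ i : Fin k, constaShift lam c i.succ = c i.castSucc := fun i => by
    simp [constaShift]; rfl
  have h2 : constaShift lam c 0 = lam * c (Fin.last k) := by
    simp only [constaShift, Fin.val_zero, if_true]; rfl
  have h3 : (⟨k + 1 - 1, by omega⟩ : Fin (k + 1)) = Fin.last k := rfl
  simp only [h1, h2, h3, Fin.val_zero, Fin.val_succ, Fin.val_castSucc, Fin.val_last, pow_zero,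
    mul_one, map_mul, mul_add, Finset.mul_sum]
  have h4 : ∑ i : Fin k, C (c i.castSucc) * X ^ ((i : ℕ) + 1) =
      ∑ i : Fin k, X * (C (c i.castSucc) * X ^ (i : ℕ)) :=
    Finset.sum_congr rfl fun i _ => by ring
  rw [h4]
  ring

theorem isConstacyclic_codeOfPoly (hn : 0 < n) {lam : F} {g : F[X]} (hg : g ∣ X ^ n - C lam) :
    IsConstacyclic lam (codeOfPoly n g) := by
  intro c hc
  rw [mem_codeOfPoly] at hc ⊢
  rw [wordPoly_constaShift hn]
  exact dvd_sub (hc.mul_left _) (hg.mul_left _)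

/-- Multiplication by g is an isomorphism from the polynomials of degree below n - deg g onto the
code. -/
theorem finrank_codeOfPoly {g : F[X]} (hg : g.Monic) (hgn : g.natDegree ≤ n) :
    Module.finrank F (codeOfPoly n g) = n - g.natDegree := by
  set d := g.natDegree with hd
  have hmem : ∀ h : degreeLT F (n - d), g * (h : F[X]) ∈ degreeLT F n := by
    intro h
    have hh := mem_degreeLT.1 h.2
    rw [mem_degreeLT, degree_mul, degree_eq_natDegree hg.ne_zero, ← hd]
    by_cases h0 : (h : F[X]) = 0
    · simp [h0]
    · rw [degree_eq_natDegree h0] at hh ⊢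
      norm_cast at hh ⊢
      omega
  set φ : degreeLT F (n - d) →ₗ[F] (Fin n → F) :=
    (degreeLTEquiv F n).toLinearMap ∘ₗ
      ((LinearMap.mulLeft F g).comp (degreeLT F (n - d)).subtype).codRestrict (degreeLT F n) hmem
  have hφw : ∀ h, wordPoly (φ h) = g * (h : F[X]) := by
    intro h
    rw [wordPoly_eq_degreeLTEquiv_symm]
    simp only [φ, LinearMap.comp_apply, LinearEquiv.coe_coe, LinearEquiv.symm_apply_apply]
    rfl
  have hinj : Function.Injective φ := by
    intro a b hab
    have := hφw a
    rw [hab, hφw b] at this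
    exact Subtype.ext (mul_left_cancel₀ hg.ne_zero this).symm
  have hrange : LinearMap.range φ = codeOfPoly n g := by
    ext c
    rw [LinearMap.mem_range, mem_codeOfPoly]
    constructor
    · rintro ⟨h, rfl⟩
      rw [hφw]
      exact dvd_mul_right _ _
    · rintro ⟨h, hh⟩
      have hdeg : h ∈ degreeLT F (n - d) := by
        have h1 := degree_wordPoly_lt c
        rw [hh, degree_mul, degree_eq_natDegree hg.ne_zero, ← hd] at h1
        rw [mem_degreeLT]
        by_cases h0 : h = 0
        · simp [h0]
        · rw [degree_eq_natDegree h0] at h1 ⊢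
          norm_cast at h1 ⊢
          omega
      refine ⟨⟨h, hdeg⟩, ?_⟩
      funext i
      rw [← coeff_wordPoly (φ _), hφw, ← hh, coeff_wordPoly]
  rw [← hrange, LinearMap.finrank_range_of_inj hinj, (degreeLTEquiv F (n - d)).finrank_eq,
    Module.finrank_fin_fun]

/-- The BCH bound: a word with zeros at `a, a γ, …, a γ ^ (A - 1)` has weight greater than `A`. -/
theorem lt_hammingNorm_of_zeros [DecidableEq F] {K : Type*} [Field K] [Algebra F K] {a γ : K}
    (ha : a ≠ 0) (hγ : Set.InjOn (fun i : ℕ => γ ^ i) (Set.Iio n)) {A : ℕ} {c : Fin n → F}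
    (hc : c ≠ 0) (hz : ∀ k < A, aeval (a * γ ^ k) (wordPoly c) = 0) : A < hammingNorm c := by
  by_contra! hA
  obtain ⟨i₀, hi₀⟩ := Function.ne_iff.1 hc
  set I : Finset (Fin n) := Finset.univ.filter fun i => c i ≠ 0
  have hi₀I : i₀ ∈ I := by simpa [I] using hi₀
  -- P has degree below A and kills γ^j for every j in the support except i₀. The combination of the
  -- A zero conditions with the coefficients of P is Σ c_i a^i P(γ^i), in which only the nonzero
  -- term at i₀ survives.
  set P : K[X] := ∏ j ∈ I.erase i₀, (X - C (γ ^ (j : ℕ))) with hP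
  have hPdeg : P.natDegree < A := by
    rw [hP, natDegree_prod_of_monic _ _ fun j _ => monic_X_sub_C _]
    simp only [natDegree_X_sub_C, Finset.sum_const, smul_eq_mul, mul_one]
    have : (I.erase i₀).card < I.card := Finset.card_erase_lt_of_mem hi₀I
    exact this.trans_le hA
  have hsum : ∑ i : Fin n, algebraMap F K (c i) * a ^ (i : ℕ) * P.eval (γ ^ (i : ℕ)) = 0 := by
    calc ∑ i : Fin n, algebraMap F K (c i) * a ^ (i : ℕ) * P.eval (γ ^ (i : ℕ))
        = ∑ i : Fin n, ∑ k ∈ Finset.range A,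
            P.coeff k * (algebraMap F K (c i) * (a * γ ^ k) ^ (i : ℕ)) := by
          refine Finset.sum_congr rfl fun i _ => ?_
          rw [eval_eq_sum_range' hPdeg, Finset.mul_sum]
          refine Finset.sum_congr rfl fun k _ => ?_
          rw [mul_pow, ← pow_mul, ← pow_mul, mul_comm k]
          ring
      _ = ∑ k ∈ Finset.range A, P.coeff k * aeval (a * γ ^ k) (wordPoly c) := by
          rw [Finset.sum_comm]
          refine Finset.sum_congr rfl fun k _ => ?_
          simp [wordPoly, Finset.mul_sum]
      _ = 0 := Finset.sum_eq_zero fun k hk => by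
          rw [hz k (Finset.mem_range.1 hk), mul_zero]
  rw [Finset.sum_eq_single i₀] at hsum
  · have h1 : P.eval (γ ^ (i₀ : ℕ)) ≠ 0 := by
      rw [hP, eval_prod, Finset.prod_ne_zero_iff]
      intro j hj
      rw [eval_sub, eval_X, eval_C, sub_ne_zero]
      intro he
      exact (Finset.mem_erase.1 hj).1 (Fin.ext (hγ i₀.2 j.2 he)).symm
    have h2 : algebraMap F K (c i₀) ≠ 0 := by
      rw [Ne, FaithfulSMul.algebraMap_eq_zero_iff]
      exact hi₀
    exact mul_ne_zero (mul_ne_zero h2 (pow_ne_zero _ ha)) h1 hsum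
  · intro j _ hj
    by_cases hcj : c j = 0
    · simp [hcj]
    · have : P.eval (γ ^ (j : ℕ)) = 0 := by
        rw [hP, eval_prod]
        exact Finset.prod_eq_zero (Finset.mem_erase.2 ⟨hj, by simpa [I] using hcj⟩) (by simp)
      rw [this, mul_zero]
  · simp

end Codes

/-! ### Existence of the codes and of the root of unity β. -/

/-- The constacyclic code with a given defining set, its dimension, and the BCH bound. -/
theorem CosetSetting.exists_code {q r n m : ℕ} (h : CosetSetting q r n m) {F K : Type*} [Field F]
    [Fintype F] [DecidableEq F] [Field K] [Algebra F K] {lam : F} (hF : Fintype.card F = q)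
    (hlam : orderOf lam = r) {β : K} (hβ : IsPrimitiveRoot β (n * r))
    (hβn : β ^ n = algebraMap F K lam) {T : Finset ℕ} (hT : T ⊆ constaIndices n r)
    (hTc : ∀ x ∈ T, cycCoset q (n * r) x ⊆ T) {A : ℕ} (hA : ∀ i < A, 1 + i * r ∈ T) :
    ∃ 𝒞 : Submodule F (Fin n → F), HasDefiningSet lam r β 𝒞 T ∧
      HasParameters 𝒞 ((n : ℤ) - T.card) (A + 1) := by
  classical
  have hN := h.modulus_pos
  have hr := h.r_pos
  have hn : 0 < n := by have := h.one_lt; omega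
  have hβ0 : β ≠ 0 := hβ.ne_zero hN.ne'
  have hlam0 : lam ≠ 0 := by
    rintro rfl
    rw [orderOf_zero] at hlam
    omega
  have hpow : ∀ a b : ℕ, a ≡ b [MOD n * r] → β ^ a = β ^ b := by
    intro a b hab
    rw [hβ.eq_orderOf] at hab
    exact (field_pow_eq_pow_iff_modEq hβ0).2 hab
  have hinjZ : Set.InjOn (fun j : ℕ => β ^ j) (constaIndices n r) := by
    intro a ha b hb hab
    obtain ⟨ha1, ha2, -⟩ := h.mem_iff.1 ha
    obtain ⟨hb1, hb2, -⟩ := h.mem_iff.1 hb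
    refine eq_of_modEq_of_mem_Icc ha1 ha2 hb1 hb2 ?_
    have := (field_pow_eq_pow_iff_modEq hβ0).1 hab
    rwa [← hβ.eq_orderOf] at this
  have hinjT : Set.InjOn (fun j : ℕ => β ^ j) T := hinjZ.mono (Finset.coe_subset.2 hT)
  -- The generator has the roots β^j for j in T. They are stable under x ↦ x^q because T is a union
  -- of cosets.
  obtain ⟨g, hgm, hg⟩ := exists_map_eq_prod_X_sub_C (F := F) (T.image fun j => β ^ j) (by
    intro x hx
    obtain ⟨j, hj, rfl⟩ := Finset.mem_image.1 hx
    obtain ⟨y, hy1, hy2, hy3⟩ := exists_modEq_mem_Icc hN (j * q)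
    refine Finset.mem_image.2 ⟨y, hTc j hj (mem_cycCoset.2 ⟨⟨hy1, hy2⟩, 1, by simpa using hy3⟩), ?_⟩
    rw [hF, ← pow_mul]
    exact hpow _ _ hy3)
  have hroot : ∀ j, j ∈ constaIndices n r → (β ^ j) ^ n = algebraMap F K lam := by
    intro j hj
    rw [← pow_mul, mul_comm, pow_mul, hβn, ← map_pow]
    congr 1
    conv_rhs => rw [← pow_one lam]
    rw [field_pow_eq_pow_iff_modEq hlam0, hlam]
    exact (h.mem_iff.1 hj).2.2
  have hdvd : g ∣ X ^ n - C lam := by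
    rw [← map_dvd_map' (algebraMap F K), hg]
    refine Finset.prod_dvd_of_coprime
      (fun x _ y _ hxy => isCoprime_X_sub_C_of_isUnit_sub (sub_ne_zero.2 hxy).isUnit) ?_
    intro x hx
    obtain ⟨j, hj, rfl⟩ := Finset.mem_image.1 hx
    rw [dvd_iff_isRoot]
    simp [hroot j (hT hj)]
  have haeval : ∀ x : K, aeval x g = 0 ↔ ∃ j ∈ T, β ^ j = x := by
    intro x
    rw [aeval_def, eval₂_eq_eval_map, hg, eval_prod, Finset.prod_eq_zero_iff]
    simp [sub_eq_zero, eq_comm]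
  have hdeg : g.natDegree = T.card := by
    rw [← natDegree_map (algebraMap F K), hg,
      natDegree_prod_of_monic _ _ fun j _ => monic_X_sub_C _]
    simp [Finset.card_image_of_injOn hinjT]
  have hcard : T.card ≤ n := by
    have := Finset.card_le_card hT
    rwa [card_constaIndices hr] at this
  refine ⟨codeOfPoly n g, ⟨isConstacyclic_codeOfPoly hn hdvd, g,
    ⟨hgm, hdvd, fun c => mem_codeOfPoly⟩, fun j => ⟨fun hj => ⟨hT hj, (haeval _).2 ⟨j, hj, rfl⟩⟩,
      fun hj => ?_⟩⟩, ?_, ?_⟩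
  · obtain ⟨i, hi, he⟩ := (haeval _).1 hj.2
    rwa [← hinjZ (hT hi) hj.1 he]
  · rw [finrank_codeOfPoly hgm (hdeg ▸ hcard), hdeg]
    omega
  · intro u hu v hv huv
    have hsub := (codeOfPoly n g).sub_mem hv hu
    rw [mem_codeOfPoly] at hsub
    -- β^{1+kr} = β (β^r)^k, and the powers of β^r with exponent below n are distinct because β has
    -- order nr.
    have := lt_hammingNorm_of_zeros (K := K) (a := β) (γ := β ^ r) (A := A) hβ0 ?_
      (sub_ne_zero.2 huv.symm) ?_
    · rw [hammingDist_eq_hammingNorm, neg_add_eq_sub]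
      exact_mod_cast this
    · intro i hi j hj hij
      simp only [← pow_mul] at hij
      rw [Set.mem_Iio] at hi hj
      have h1 := hβ.pow_inj (Nat.mul_comm r i ▸ Nat.mul_lt_mul_of_pos_right hi hr)
        (Nat.mul_comm r j ▸ Nat.mul_lt_mul_of_pos_right hj hr) hij
      exact Nat.eq_of_mul_eq_mul_left hr h1
    · intro k hk
      obtain ⟨p, hp⟩ := hsub
      rw [hp, map_mul, (haeval _).2 ⟨_, hA k hk, ?_⟩, zero_mul]
      rw [pow_add, pow_one, ← pow_mul, mul_comm k]

/-- There is a primitive `n r`-th root of unity with prescribed `n`-th power of order `r`. -/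
theorem CosetSetting.exists_primitiveRoot {q r n m : ℕ} (h : CosetSetting q r n m) {F : Type*}
    [Field F] [Fintype F] {lam : F} (hF : Fintype.card F = q) (hlam : orderOf lam = r) :
    ∃ β : AlgebraicClosure F, IsPrimitiveRoot β (n * r) ∧
      β ^ n = algebraMap F (AlgebraicClosure F) lam := by
  set K := AlgebraicClosure F
  have hN := h.modulus_pos
  have hr := h.r_pos
  have : NeZero (n * r) := ⟨hN.ne'⟩
  have : NeZero r := ⟨hr.ne'⟩
  -- The characteristic does not divide nr: otherwise q^m ≡ 1 modulo nr would give q^m = 1 in K,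
  -- where q = 0.
  have : NeZero ((n * r : ℕ) : K) := by
    constructor
    intro h0
    have h1 : ((q ^ m : ℕ) : K) = ((1 : ℕ) : K) := by
      obtain ⟨k, hk⟩ := h.dvd_pow
      have h2 : q ^ m = n * r * k + 1 := by
        have : 1 ≤ q ^ m := Nat.one_le_pow _ _ (by have := h.two_le; omega)
        omega
      rw [h2, Nat.cast_add, Nat.cast_mul, h0, zero_mul, zero_add]
    have h3 : (q : K) = 0 := by
      rw [← hF, ← map_natCast (algebraMap F K), FiniteField.cast_card_eq_zero, map_zero]
    rw [Nat.cast_pow, h3, zero_pow (by have := h.one_lt_size; omega), Nat.cast_one] at h1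
    exact zero_ne_one h1
  obtain ⟨β, hβ⟩ := HasEnoughRootsOfUnity.exists_primitiveRoot K (n * r)
  have hβn : IsPrimitiveRoot (β ^ n) r := hβ.pow hN rfl
  have hl : IsPrimitiveRoot (algebraMap F K lam) r :=
    (hlam ▸ IsPrimitiveRoot.orderOf lam).map_of_injective (algebraMap F K).injective
  obtain ⟨k, -, hk⟩ := hβn.eq_pow_of_pow_eq_one hl.pow_eq_one
  have hkr : k.Coprime r := by
    rw [← hk] at hl
    exact (hβn.pow_iff_coprime hr k).1 hl
  -- Here λ = (β^n)^k with k prime to r. Lifting k to a unit u modulo nr allows β to be replaced by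
  -- the primitive root β^u.
  obtain ⟨u, hu⟩ := ZMod.unitsMap_surjective (Dvd.intro_left n rfl : r ∣ n * r)
    (ZMod.unitOfCoprime k hkr)
  refine ⟨β ^ (u : ZMod (n * r)).val, hβ.pow_of_coprime _ (ZMod.val_coe_unit_coprime u), ?_⟩
  rw [← pow_mul, mul_comm, pow_mul, ← hk, field_pow_eq_pow_iff_modEq (hβn.ne_zero hr.ne'),
    ← hβn.eq_orderOf,
    ← ZMod.natCast_eq_natCast_iff]
  have := congrArg Units.val hu
  rw [ZMod.unitsMap_val, ZMod.coe_unitOfCoprime] at this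
  rw [← this, ZMod.natCast_val]

/-! ### Arithmetic of Φ_{p₁p₂}(q). -/

section CyclotomicValue

variable {q r p₁ p₂ n : ℕ}

/-- The value `Φ_{p₁ p₂}(q)` times the least common multiple of `q ^ p₁ - 1` and `q ^ p₂ - 1`. -/
theorem eval_cyclotomic_mul_lcm (hq : 2 ≤ q) (hp₁ : p₁.Prime) (hp₂ : p₂.Prime) (hlt : p₁ < p₂)
    (hn : (n : ℤ) = (cyclotomic (p₁ * p₂) ℤ).eval (q : ℤ)) :
    n * Nat.lcm (q ^ p₁ - 1) (q ^ p₂ - 1) = q ^ (p₁ * p₂) - 1 := by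
  have : Fact p₁.Prime := ⟨hp₁⟩
  have hone : ∀ k, 1 ≤ q ^ k := fun k => Nat.one_le_pow _ _ (by omega)
  -- Φ_{p₁}(x^{p₂}) = Φ_{p₁p₂}(x) Φ_{p₁}(x), combined below with Φ_{p₁}(y)(y - 1) = y^{p₁} - 1 at y
  -- = q and y = q^{p₂}.
  have hexp := congrArg (eval (q : ℤ)) (cyclotomic_expand_eq_cyclotomic_mul hp₂
    (fun hd => hlt.not_ge (Nat.le_of_dvd hp₁.pos hd)) ℤ)
  rw [expand_eval, eval_mul, ← hn] at hexp
  have hprime : ∀ x : ℤ, (cyclotomic p₁ ℤ).eval x * (x - 1) = x ^ p₁ - 1 := fun x => by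
    have := congrArg (eval x) (cyclotomic_prime_mul_X_sub_one ℤ p₁)
    simpa using this
  have h1 := hprime ((q : ℤ) ^ p₂)
  rw [hexp, ← pow_mul, mul_comm p₂] at h1
  have h2 : (n : ℤ) * ((q ^ p₁ - 1) * (q ^ p₂ - 1)) = (q ^ (p₁ * p₂) - 1) * (q - 1) := by
    rw [← h1, ← hprime q]
    ring
  have h3 : n * ((q ^ p₁ - 1) * (q ^ p₂ - 1)) = (q ^ (p₁ * p₂) - 1) * (q - 1) := by
    zify [hone p₁, hone p₂, hone (p₁ * p₂), (by omega : 1 ≤ q)]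
    exact h2
  have h4 := Nat.gcd_mul_lcm (q ^ p₁ - 1) (q ^ p₂ - 1)
  rw [Nat.pow_sub_one_gcd_pow_sub_one, (Nat.coprime_primes hp₁ hp₂).2 hlt.ne, pow_one] at h4
  rw [← h4] at h3
  exact Nat.eq_of_mul_eq_mul_right (by omega : 0 < q - 1) (by rw [← h3]; ring)

/-- The order of `q` modulo a prime divisor of `Φ_k(q)` that does not divide `k`. -/
theorem orderOf_of_dvd_eval_cyclotomic {k l : ℕ} [Fact l.Prime] (hk : ¬ l ∣ k)
    (h : (cyclotomic k (ZMod l)).eval (q : ZMod l) = 0) : orderOf (q : ZMod l) = k := by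
  have : NeZero (k : ZMod l) := ⟨by rwa [Ne, ZMod.natCast_eq_zero_iff]⟩
  exact (isRoot_cyclotomic_iff.1 h).eq_orderOf.symm

/-- This is where the primality of p₁ and p₂ and the condition on p₂ enter; the coset and code
arguments use only the resulting `CosetSetting`. -/
theorem cosetSetting_of_eval_cyclotomic (hq : 2 ≤ q) (hr : r ∣ q - 1) (hp₁ : p₁.Prime)
    (hp₂ : p₂.Prime) (hlt : p₁ < p₂) (hndvd : ¬ p₂ ∣ (q ^ p₁ - 1) / r)
    (hn : (n : ℤ) = (cyclotomic (p₁ * p₂) ℤ).eval (q : ℤ)) :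
    CosetSetting q r n (p₁ * p₂) := by
  have hm : 1 < p₁ * p₂ := lt_of_lt_of_le hp₁.one_lt (Nat.le_mul_of_pos_right _ hp₂.pos)
  have hne : p₁ ≠ p₂ := hlt.ne
  have hpp : ∀ {p : ℕ}, p.Prime → ∀ k : ℕ, p ^ k ≠ p₁ * p₂ := by
    intro p hp k hk
    have h1 := hp₁.dvd_of_dvd_pow (hk ▸ dvd_mul_right p₁ p₂ : p₁ ∣ p ^ k)
    have h2 := hp₂.dvd_of_dvd_pow (hk ▸ dvd_mul_left p₂ p₁ : p₂ ∣ p ^ k)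
    exact hne (((Nat.prime_dvd_prime_iff_eq hp₁ hp).1 h1).trans
      ((Nat.prime_dvd_prime_iff_eq hp₂ hp).1 h2).symm)
  have hone : ∀ k, 1 ≤ q ^ k := fun k => Nat.one_le_pow _ _ (by omega)
  refine ⟨hq, hr, ?_, hm, ?_, ?_, ?_⟩
  · have := sub_one_lt_natAbs_cyclotomic_eval hm (by omega : q ≠ 1)
    rw [← hn, Int.natAbs_natCast] at this
    omega
  · have h1 := (cyclotomic (p₁ * p₂) ℤ).sub_dvd_eval_sub (q : ℤ) 1
    rw [← hn, eval_one_cyclotomic_not_prime_pow hpp] at h1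
    have h2 : (r : ℤ) ∣ (q : ℤ) - 1 := by
      have := Int.natCast_dvd_natCast.2 hr
      rwa [Nat.cast_sub (by omega), Nat.cast_one] at this
    exact ((Nat.modEq_iff_dvd).2 (by simpa using h2.trans h1)).symm
  · rw [← eval_cyclotomic_mul_lcm hq hp₁ hp₂ hlt hn]
    refine mul_dvd_mul_left n (hr.trans (dvd_trans ?_ (Nat.dvd_lcm_left _ _)))
    simpa using Nat.pow_sub_one_dvd_pow_sub_one q (one_dvd p₁)
  · intro l hl hln
    have : Fact l.Prime := ⟨hl⟩
    have heval : (cyclotomic (p₁ * p₂) (ZMod l)).eval (q : ZMod l) = 0 := by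
      rw [← map_cyclotomic_int, ← Int.cast_natCast (R := ZMod l) q, ← eq_intCast (Int.castRingHom _),
        eval_map_apply, ← hn]
      simpa [ZMod.natCast_eq_zero_iff] using hln
    refine orderOf_of_dvd_eval_cyclotomic (fun hd => ?_) heval
    rcases (Nat.Prime.dvd_mul hl).1 hd with hd | hd
    -- Case l = p₁: modulo p₁, Φ_m is a power of Φ_{p₂}, so q has order p₂, which would divide p₁ -
    -- 1 < p₂.
    · obtain rfl := (Nat.prime_dvd_prime_iff_eq hl hp₁).1 hd
      have hd' : ¬ l ∣ p₂ := fun hd' => hne ((Nat.prime_dvd_prime_iff_eq hl hp₂).1 hd')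
      rw [mul_comm, cyclotomic_mul_prime_eq_pow_of_not_dvd _ hd', eval_pow] at heval
      have hord := orderOf_of_dvd_eval_cyclotomic hd' (eq_zero_of_pow_eq_zero heval)
      have h0 : (q : ZMod l) ≠ 0 := by
        intro h0
        rw [h0, orderOf_zero] at hord
        exact hp₂.ne_zero hord.symm
      have := Nat.le_of_dvd (by have := hl.two_le; omega) (hord ▸ ZMod.orderOf_dvd_card_sub_one h0)
      omega
    -- Case l = p₂: now q has order p₁ modulo p₂, so p₂ divides q^{p₁} - 1. It cannot divide r,
    -- since then q ≡ 1 would have order 1; so it divides (q^{p₁} - 1)/r.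
    · obtain rfl := (Nat.prime_dvd_prime_iff_eq hl hp₂).1 hd
      have hd' : ¬ l ∣ p₁ := fun hd' => hne ((Nat.prime_dvd_prime_iff_eq hl hp₁).1 hd').symm
      rw [cyclotomic_mul_prime_eq_pow_of_not_dvd _ hd', eval_pow] at heval
      have hord := orderOf_of_dvd_eval_cyclotomic hd' (eq_zero_of_pow_eq_zero heval)
      have h1 : l ∣ q ^ p₁ - 1 := by
        rw [← ZMod.natCast_eq_zero_iff, Nat.cast_sub (hone _), Nat.cast_pow, Nat.cast_one, ← hord,
          pow_orderOf_eq_one, sub_self]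
      have hrq : r ∣ q ^ p₁ - 1 := hr.trans (by
        simpa using Nat.pow_sub_one_dvd_pow_sub_one q (one_dvd p₁))
      rw [← Nat.mul_div_cancel' hrq] at h1
      rcases (Nat.Prime.dvd_mul hl).1 h1 with h2 | h2
      · have h3 : (q : ZMod l) = 1 := by
          have := (ZMod.natCast_eq_zero_iff _ _).2 (h2.trans hr)
          rwa [Nat.cast_sub (by omega), Nat.cast_one, sub_eq_zero] at this
        rw [h3, orderOf_one] at hord
        exact hp₁.one_lt.ne hord
      · exact hndvd h2

end CyclotomicValue

/-! ### Rounding, and the parameters of the two codes. -/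

/-- From q⌊A/q⌋ ≥ A - (q-1) one gets qL ≤ qA - A + (q-1). -/
theorem mul_le_of_add_div_le {q L A : ℕ} (hq : 0 < q) (hL : L + A / q ≤ A) :
    q * L ≤ (A + 1) * (q - 1) := by
  obtain ⟨k, rfl⟩ : ∃ k, q = k + 1 := ⟨q - 1, by omega⟩
  rw [Nat.add_sub_cancel]
  have h1 := Nat.div_add_mod A (k + 1)
  have h2 := Nat.mod_lt A hq
  nlinarith

theorem ceil_half (N : ℕ) : ⌈(N : ℚ) / 2⌉ = ((N + 1) / 2 : ℕ) := by
  rw [Int.ceil_eq_iff]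
  rcases Nat.even_or_odd' N with ⟨k, rfl | rfl⟩
  · rw [show (2 * k + 1) / 2 = k by omega]
    push_cast
    constructor <;> linarith
  · rw [show (2 * k + 1 + 1) / 2 = k + 1 by omega]
    push_cast
    constructor <;> linarith

theorem natCeil_half (N : ℕ) : ⌈(N : ℚ) / 2⌉₊ = (N + 1) / 2 := by
  have h := ceil_half N
  rw [← Int.natCast_ceil_eq_ceil (by positivity)] at h
  exact_mod_cast h

theorem natFloor_half (N : ℕ) : ⌊(N : ℚ) / 2⌋₊ = N / 2 := by
  simpa using Nat.floor_div_natCast (N : ℚ) 2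

theorem floor_half (N : ℕ) : ⌊(N : ℚ) / 2⌋ = (N / 2 : ℕ) := by
  rw [← natFloor_half, Int.natCast_floor_eq_floor (by positivity)]

theorem firstCosets_zero (q n r l : ℕ) : firstCosets q n r l 0 = ∅ := by
  simp [firstCosets]

namespace CosetSetting

variable {q r n m : ℕ}

theorem size_lt (h : CosetSetting q r n m) : m < n := by
  have h1 := h.numCosets_mul
  have h2 := Nat.le_mul_of_pos_left m h.numCosets_pos
  omega

/-- The first `A` elements of `Z_{n,r}`, other than `n`, lie in the union of the first `k` cosets of
size `m` if at most `k` leaders are among them. -/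
theorem mem_firstCosets_of_card_le (h : CosetSetting q r n m) {A k i : ℕ} (hAn : A ≤ n)
    (hi : i < A) (hne : 1 + i * r ≠ n)
    (hk : ((cosetLeaders q n r m).filter fun x => x < 1 + A * r).card ≤ k) :
    1 + i * r ∈ firstCosets q n r m k := by
  have hZ : 1 + i * r ∈ constaIndices n r :=
    Finset.mem_image.2 ⟨i, Finset.mem_range.2 (by omega), rfl⟩
  refine h.mem_firstCosets hZ (by rw [h.card_cycCoset hZ, if_neg hne]) (le_trans ?_ hk)
  apply Finset.card_le_card
  intro x hx
  rw [Finset.mem_filter] at hx ⊢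
  have := Nat.mul_lt_mul_of_pos_right hi h.r_pos
  exact ⟨hx.1, by omega⟩

theorem firstCosets_one_one (h : CosetSetting q r n m) : firstCosets q n r 1 1 = {n} := by
  have : cycCoset q (n * r) n = {n} := h.cycCoset_n
  simp [firstCosets, h.cosetLeaders_one, Finset.filter_singleton, this]

theorem notMem_firstCosets (h : CosetSetting q r n m) (k : ℕ) : n ∉ firstCosets q n r m k := by
  intro hn
  have := h.card_cycCoset_of_mem_firstCosets hn
  rw [h.cycCoset_n, Finset.card_singleton] at this
  exact h.one_lt_size.ne this

/-- The code of the first half, rounded up, of the cosets of either size. -/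
theorem exists_ceil_code (h : CosetSetting q r n m) {F K : Type*} [Field F] [Fintype F]
    [DecidableEq F] [Field K] [Algebra F K] {lam : F} (hF : Fintype.card F = q)
    (hlam : orderOf lam = r) {β : K} (hβ : IsPrimitiveRoot β (n * r))
    (hβn : β ^ n = algebraMap F K lam) {s : ℕ} (hs : 0 < s) {N : ℕ}
    (hN : N = numCosets q n r m) :
    ∃ 𝒞 : Submodule F (Fin n → F), HasDefiningSet lam r β 𝒞 (ceilDefiningSet q n r 1 m) ∧
      HasParameters 𝒞 ((n : ℤ) - 1 - m * ⌈(N : ℚ) / 2⌉)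
        (⌈(q : ℚ) * ⌈(N : ℚ) / 2⌉ / (q - 1)⌉ + correctionTerm q r s m N) := by
  classical
  have hq := h.two_le
  have hNpos := h.numCosets_pos
  have hNm := h.numCosets_mul
  have hm := h.one_lt_size
  rw [← hN] at hNpos hNm
  set k := (N + 1) / 2 with hk
  have hkN : k ≤ N := by omega
  have hNn : N + 1 ≤ n := by nlinarith
  have hT : ceilDefiningSet q n r 1 m = {n} ∪ firstCosets q n r m k := by
    rw [ceilDefiningSet, h.numCosets_one, ← hN, natCeil_half, natCeil_half, h.firstCosets_one_one]
  have hTcard : (ceilDefiningSet q n r 1 m).card = 1 + k * m := by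
    rw [hT, Finset.card_union_of_disjoint, h.card_firstCosets (hN ▸ hkN), Finset.card_singleton]
    exact Finset.disjoint_singleton_left.2 (h.notMem_firstCosets k)
  have hTZ : ceilDefiningSet q n r 1 m ⊆ constaIndices n r := by
    rw [hT]
    exact Finset.union_subset (Finset.singleton_subset_iff.2 h.n_mem) h.firstCosets_subset
  have hTc : ∀ x ∈ ceilDefiningSet q n r 1 m,
      cycCoset q (n * r) x ⊆ ceilDefiningSet q n r 1 m := by
    intro x hx
    rw [hT] at hx ⊢
    rcases Finset.mem_union.1 hx with hx | hx
    · rw [Finset.mem_singleton.1 hx, h.cycCoset_n]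
      exact Finset.subset_union_left
    · exact (h.cycCoset_subset_firstCosets hx).trans Finset.subset_union_right
  set M := (correctionSet q r s m N).ncard with hM
  have hqQ : (0 : ℚ) < (q : ℚ) - 1 := by
    have : (2 : ℚ) ≤ q := by exact_mod_cast hq
    linarith
  set a := ⌈(q : ℚ) * ⌈(N : ℚ) / 2⌉ / (q - 1)⌉ with ha
  set b := ⌈(q : ℚ) * M / (q - 1)⌉ with hb
  have ha' : a = ⌈(q : ℚ) * k / (q - 1)⌉ := by
    rw [ha, ceil_half, Int.cast_natCast]
  have hlt : ∀ x : ℕ, (⌈(q : ℚ) * x / (q - 1)⌉ - 1) * ((q : ℤ) - 1) < q * x := by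
    intro x
    have h1 := Int.ceil_lt_add_one ((q : ℚ) * x / (q - 1))
    rw [← sub_lt_iff_lt_add, lt_div_iff₀ hqQ] at h1
    exact_mod_cast h1
  have hge : ∀ x : ℕ, (q : ℤ) * x ≤ ⌈(q : ℚ) * x / (q - 1)⌉ * ((q : ℤ) - 1) := by
    intro x
    have h1 := Int.le_ceil ((q : ℚ) * x / (q - 1))
    rw [div_le_iff₀ hqQ] at h1
    exact_mod_cast h1
  have hgt : ∀ x : ℕ, 0 < x → (2 : ℤ) ≤ ⌈(q : ℚ) * x / (q - 1)⌉ := by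
    intro x hx
    have h1 := hge x
    by_contra! h2
    nlinarith
  have ha2 : 2 ≤ a := ha' ▸ hgt k (by omega)
  have hab : (a - 1) * ((q : ℤ) - 1) < q * k := ha' ▸ hlt k
  have hbb : (b - 1) * ((q : ℤ) - 1) < q * M := hlt M
  have hb0 : 0 ≤ b := Int.ceil_nonneg (by positivity)
  have han : a - 1 ≤ n := by
    by_contra! h1
    nlinarith
  -- The claimed distance is a + b - 1 and the BCH bound gives A + 1. If S_m is empty then b = 0 and
  -- A = a - 2; otherwise b ≥ 2, so A exceeds the indices of the elements from S_m, which are below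
  -- a - 1.
  obtain ⟨A, hA⟩ : ∃ A : ℕ, (A : ℤ) = a + b - 2 := ⟨(a + b - 2).toNat, by omega⟩
  obtain ⟨S, hSM, hS⟩ : ∃ S : Finset ℕ, S.card = M ∧
      ∀ x ∈ S, ¬ q ∣ x ∧ x ∉ cosetLeaders q n r m ∧ ∃ i < min A n, x = 1 + i * r := by
    rcases Nat.eq_zero_or_pos M with hM0 | hM0
    · exact ⟨∅, by simp [hM0], by simp⟩
    · have hb2 : 2 ≤ b := hgt M hM0
      exact h.exists_finset_of_correctionSet hs (by push_cast; omega)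
  have hL := h.card_leaders_le S hS
  set L := ((cosetLeaders q n r m).filter fun x => x < 1 + min A n * r).card
  -- The count gives q(L + M) ≤ (a + b - 1)(q-1), and the strict ceiling estimates bound the right
  -- side by less than q(k + M + 1).
  have hLk : L ≤ k := by
    have h1 := mul_le_of_add_div_le (by omega) hL
    rw [hSM] at h1
    zify [(by omega : 1 ≤ q)] at h1
    have h2 : (min (A : ℤ) n + 1) * ((q : ℤ) - 1) ≤ (a + b - 1) * (q - 1) :=
      mul_le_mul_of_nonneg_right (by omega) (by omega)
    by_contra! h3
    have h4 : (k : ℤ) + 1 ≤ L := by exact_mod_cast h3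
    nlinarith
  obtain ⟨𝒞, hdef, hdim, hdist⟩ := h.exists_code hF hlam hβ hβn hTZ hTc (A := min A n) (by
    intro i hi
    rw [hT, Finset.mem_union, Finset.mem_singleton]
    by_cases hin : 1 + i * r = n
    · exact Or.inl hin
    · exact Or.inr (h.mem_firstCosets_of_card_le (min_le_right _ _) hi hin hLk))
  refine ⟨𝒞, hdef, ?_, fun u hu v hv huv => ?_⟩
  · rw [hdim, hTcard, ceil_half, ← hk]
    push_cast
    ring
  -- If A ≥ n, the bound would exceed the length n, so there are no two distinct codewords.
  · have h1 := hdist u hu v hv huv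
    have h2 : hammingDist u v ≤ n := by simpa using hammingDist_le_card_fintype (x := u) (y := v)
    rw [correctionTerm, ← hM, ← hb]
    omega

/-- The code of the first half, rounded down, of the cosets of either size. -/
theorem exists_floor_code (h : CosetSetting q r n m) {F K : Type*} [Field F] [Fintype F]
    [DecidableEq F] [Field K] [Algebra F K] {lam : F} (hF : Fintype.card F = q)
    (hlam : orderOf lam = r) {β : K} (hβ : IsPrimitiveRoot β (n * r))
    (hβn : β ^ n = algebraMap F K lam) (hqr : q * r ≤ 2 * m * (q - 1)) {N : ℕ}
    (hN : N = numCosets q n r m) :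
    ∃ 𝒞 : Submodule F (Fin n → F), HasDefiningSet lam r β 𝒞 (floorDefiningSet q n r 1 m) ∧
      HasParameters 𝒞 ((n : ℤ) - m * ⌊(N : ℚ) / 2⌋) ⌊(q : ℚ) * N / (2 * (q - 1))⌋ := by
  classical
  have hq := h.two_le
  have hr := h.r_pos
  have hNm := h.numCosets_mul
  have hm := h.one_lt_size
  rw [← hN] at hNm
  have hT : floorDefiningSet q n r 1 m = firstCosets q n r m (N / 2) := by
    rw [floorDefiningSet, h.numCosets_one, ← hN, natFloor_half, natFloor_half,
      firstCosets_zero, Finset.empty_union]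
  set k := N / 2 with hk
  have hqQ : (0 : ℚ) < 2 * ((q : ℚ) - 1) := by
    have : (2 : ℚ) ≤ q := by exact_mod_cast hq
    linarith
  obtain ⟨d, hd⟩ : ∃ d : ℕ, (d : ℤ) = ⌊(q : ℚ) * N / (2 * (q - 1))⌋ :=
    ⟨_, Int.toNat_of_nonneg (Int.floor_nonneg.2 (by positivity))⟩
  have hdle : d * (2 * (q - 1)) ≤ q * N := by
    have h1 := Int.floor_le ((q : ℚ) * N / (2 * (q - 1)))
    rw [← hd, le_div_iff₀ hqQ] at h1
    zify [(by omega : 1 ≤ q)]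
    exact_mod_cast h1
  -- The coset {n} is left out of this defining set, so the run of zeros must stop before n. The
  -- hypothesis `hqr` gives d ≤ qN/(2(q-1)) ≤ Nm/r, where Nm = n - 1.
  have hdr : d * r + 1 ≤ n := by
    have h1 : d * r * (2 * (q - 1) * m) ≤ (N * m) * (2 * (q - 1) * m) :=
      calc d * r * (2 * (q - 1) * m) = d * (2 * (q - 1)) * (r * m) := by ring
        _ ≤ q * N * (r * m) := Nat.mul_le_mul_right _ hdle
        _ = N * m * (q * r) := by ring
        _ ≤ N * m * (2 * m * (q - 1)) := Nat.mul_le_mul_left _ hqr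
        _ = (N * m) * (2 * (q - 1) * m) := by ring
    have h2 := Nat.le_of_mul_le_mul_right h1
      (Nat.mul_pos (by omega : 0 < 2 * (q - 1)) (by omega))
    omega
  have hdn : d ≤ n := by
    have := Nat.le_mul_of_pos_right d hr
    omega
  have hLk : ((cosetLeaders q n r m).filter fun x => x < 1 + (d - 1) * r).card ≤ k := by
    have hL := h.card_leaders_le (A := d - 1) ∅ (by simp)
    rw [Finset.card_empty, add_zero] at hL
    set L := ((cosetLeaders q n r m).filter fun x => x < 1 + (d - 1) * r).card
    rcases Nat.eq_zero_or_pos d with h0 | h0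
    · have := (Nat.le_add_right _ _).trans hL
      omega
    · have h1 := mul_le_of_add_div_le (by omega) hL
      rw [Nat.sub_add_cancel h0] at h1
      have h2 : q * (2 * L) ≤ q * N := by
        calc q * (2 * L) = 2 * (q * L) := by ring
          _ ≤ 2 * (d * (q - 1)) := Nat.mul_le_mul_left _ h1
          _ = d * (2 * (q - 1)) := by ring
          _ ≤ q * N := hdle
      have := Nat.le_of_mul_le_mul_left h2 (by omega)
      omega
  obtain ⟨𝒞, hdef, hdim, hdist⟩ := h.exists_code hF hlam hβ hβn (T := firstCosets q n r m k)
    h.firstCosets_subset (fun x hx => h.cycCoset_subset_firstCosets hx) (A := d - 1) (by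
      intro i hi
      refine h.mem_firstCosets_of_card_le (by omega) hi ?_ hLk
      have : i * r < d * r := Nat.mul_lt_mul_of_pos_right (by omega) hr
      omega)
  refine ⟨𝒞, hT ▸ hdef, ?_, fun u hu v hv huv => ?_⟩
  · rw [hdim, h.card_firstCosets (by omega), floor_half, ← hk]
    push_cast
    ring
  · have h1 := hdist u hu v hv huv
    rw [← hd]
    omega

end CosetSetting

/-! ### The main theorem. -/

theorem theorem8 (q r p₁ : ℕ) (hq : IsPrimePow q) (hr : r ∣ q - 1) (hp₁ : p₁.Prime) :
    -- infinitely many lengths occur (for fixed `q`, `r` and `p₁`)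
    {n : ℕ | ∃ p₂ : ℕ, p₂.Prime ∧ p₁ < p₂ ∧ ¬ p₂ ∣ (q ^ p₁ - 1) / r ∧
      (r ≤ 3 ∨ q * r ≤ 2 * p₁ * p₂ * (q - 1)) ∧
      (n : ℤ) = (cyclotomic (p₁ * p₂) ℤ).eval (q : ℤ)}.Infinite ∧
    ∀ p₂ n : ℕ, p₂.Prime → p₁ < p₂ → ¬ p₂ ∣ (q ^ p₁ - 1) / r →
      (n : ℤ) = (cyclotomic (p₁ * p₂) ℤ).eval (q : ℤ) →
      n * Nat.lcm (q ^ p₁ - 1) (q ^ p₂ - 1) = q ^ (p₁ * p₂) - 1 ∧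
      -- the sizes of the cosets, and the number of cosets of each size
      ((constaIndices n r).image fun i => (cycCoset q (n * r) i).card) = {1, p₁ * p₂} ∧
      numCosets q n r 1 = 1 ∧
      (numCosets q n r (p₁ * p₂) : ℚ) = ((n : ℚ) - 1) / (p₁ * p₂) ∧
      -- the codes, over any field with `q` elements and for any `lam` of order `r`
      ∀ (F : Type*) [Field F] [Fintype F] [DecidableEq F] (lam : F),
        Fintype.card F = q → orderOf lam = r →
        (∃ β : AlgebraicClosure F, IsPrimitiveRoot β (n * r) ∧
          β ^ n = algebraMap F (AlgebraicClosure F) lam) ∧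
        ∀ β : AlgebraicClosure F, IsPrimitiveRoot β (n * r) →
          β ^ n = algebraMap F (AlgebraicClosure F) lam →
          (∃ 𝒞 : Submodule F (Fin n → F),
            HasDefiningSet lam r β 𝒞 (ceilDefiningSet q n r 1 (p₁ * p₂)) ∧
            HasParameters 𝒞
              ((n : ℤ) - 1 - p₁ * p₂ * ⌈((n : ℚ) - 1) / (2 * p₁ * p₂)⌉)
              (⌈(q : ℚ) * ⌈((n : ℚ) - 1) / (2 * p₁ * p₂)⌉ / (q - 1)⌉ +
                correctionTerm q r (Nat.lcm (q ^ p₁ - 1) (q ^ p₂ - 1) / r) (p₁ * p₂)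
                  (numCosets q n r (p₁ * p₂)))) ∧
          (r ≤ 3 ∨ q * r ≤ 2 * p₁ * p₂ * (q - 1) →
            ∃ 𝒞 : Submodule F (Fin n → F),
              HasDefiningSet lam r β 𝒞 (floorDefiningSet q n r 1 (p₁ * p₂)) ∧
              HasParameters 𝒞
                ((n : ℤ) - p₁ * p₂ * ⌊((n : ℚ) - 1) / (2 * p₁ * p₂)⌋)
                ⌊(q : ℚ) * ((n : ℚ) - 1) / (2 * p₁ * p₂ * (q - 1))⌋) := by
  have hq2 : 2 ≤ q := hq.two_le
  refine ⟨Set.infinite_of_forall_exists_gt fun a => ?_, ?_⟩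
  -- A prime above q^{p₁} cannot divide the positive number (q^{p₁} - 1)/r, one above qr satisfies
  -- the condition of (c), and n > p₁p₂ ≥ p₂ > a makes the length exceed a.
  · obtain ⟨p₂, hle, hp₂⟩ := Nat.exists_infinite_primes (a + p₁ + q ^ p₁ + q * r + 1)
    have hlt : p₁ < p₂ := by omega
    have hone : 1 < q ^ p₁ := Nat.one_lt_pow hp₁.ne_zero (by omega)
    have hrle : r ≤ q ^ p₁ - 1 := by
      have h1 := Nat.le_of_dvd (by omega) hr
      have h2 : q ≤ q ^ p₁ := Nat.le_self_pow hp₁.ne_zero q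
      omega
    have hr0 : 0 < r := Nat.pos_of_dvd_of_pos hr (by omega)
    have hndvd : ¬ p₂ ∣ (q ^ p₁ - 1) / r := by
      intro hd
      have h1 := Nat.le_of_dvd (Nat.div_pos hrle hr0) hd
      have h2 := Nat.div_le_self (q ^ p₁ - 1) r
      omega
    have hm : p₂ ≤ p₁ * p₂ := Nat.le_mul_of_pos_left _ hp₁.pos
    have hpos := cyclotomic_pos (n := p₁ * p₂)
      (by have := hp₁.two_le; omega) (q : ℤ)
    obtain ⟨n, hn⟩ := Int.eq_ofNat_of_zero_le hpos.le
    have h := cosetSetting_of_eval_cyclotomic hq2 hr hp₁ hp₂ hlt hndvd hn.symm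
    refine ⟨n, ⟨p₂, hp₂, hlt, hndvd, Or.inr ?_, hn.symm⟩, ?_⟩
    · calc q * r ≤ p₂ := by omega
        _ ≤ p₁ * p₂ := hm
        _ ≤ 2 * (p₁ * p₂) := by omega
        _ = 2 * p₁ * p₂ := by ring
        _ ≤ 2 * p₁ * p₂ * (q - 1) := Nat.le_mul_of_pos_right _ (by omega)
    · have := h.size_lt
      omega
  · intro p₂ n hp₂ hlt hndvd hn
    have h := cosetSetting_of_eval_cyclotomic hq2 hr hp₁ hp₂ hlt hndvd hn
    have hm0 : (0 : ℚ) < (p₁ : ℚ) * p₂ := by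
      have := hp₁.pos
      have := hp₂.pos
      positivity
    have hNm := h.numCosets_mul
    set N := numCosets q n r (p₁ * p₂) with hN
    have hnQ : (n : ℚ) - 1 = N * (p₁ * p₂) := by
      rw [← hNm]
      push_cast
      ring
    have hhalf : ((n : ℚ) - 1) / (2 * p₁ * p₂) = N / 2 := by
      rw [hnQ, mul_assoc, mul_div_mul_right _ _ hm0.ne']
    have hquot : (q : ℚ) * ((n : ℚ) - 1) / (2 * p₁ * p₂ * (q - 1)) = q * N / (2 * (q - 1)) := by
      have : (q : ℚ) * ((n : ℚ) - 1) / (2 * p₁ * p₂ * (q - 1)) =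
          q * (((n : ℚ) - 1) / (2 * p₁ * p₂)) / (q - 1) := by
        rw [← mul_div_assoc, div_div]
      rw [this, hhalf, ← mul_div_assoc, div_div]
    refine ⟨eval_cyclotomic_mul_lcm hq2 hp₁ hp₂ hlt hn, h.image_card_cycCoset, h.numCosets_one,
      ?_, ?_⟩
    · rw [hnQ, mul_div_cancel_right₀ _ hm0.ne']
    · intro F _ _ _ lam hF hlam
      refine ⟨h.exists_primitiveRoot hF hlam, fun β hβ hβn => ⟨?_, fun hcond => ?_⟩⟩
      · have hs : 0 < Nat.lcm (q ^ p₁ - 1) (q ^ p₂ - 1) / r := by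
          have h1 : ∀ p : ℕ, p.Prime → 0 < q ^ p - 1 := fun p hp => by
            have := Nat.one_lt_pow hp.ne_zero (by omega : 1 < q)
            omega
          refine Nat.div_pos (Nat.le_of_dvd (Nat.lcm_pos (h1 _ hp₁) (h1 _ hp₂)) ?_) h.r_pos
          refine hr.trans (dvd_trans ?_ (Nat.dvd_lcm_left _ _))
          simpa using Nat.pow_sub_one_dvd_pow_sub_one q (one_dvd p₁)
        have := h.exists_ceil_code hF hlam hβ hβn hs hN
        rw [hhalf]
        exact_mod_cast this
      · have hqr : q * r ≤ 2 * (p₁ * p₂) * (q - 1) := by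
          -- For r ≤ 3 the inequality is automatic, from q ≤ 2(q-1) and p₁p₂ ≥ 3.
          rcases hcond with hr3 | hle
          · have h1 : 3 ≤ p₁ * p₂ := by
              have := hp₁.two_le
              have := hp₂.two_le
              nlinarith
            calc q * r ≤ (2 * (q - 1)) * 3 := Nat.mul_le_mul (by omega) hr3
              _ ≤ (2 * (q - 1)) * (p₁ * p₂) := Nat.mul_le_mul_left _ h1
              _ = 2 * (p₁ * p₂) * (q - 1) := by ring
          · rwa [← mul_assoc]
        have := h.exists_floor_code hF hlam hβ hβn hqr hN
        rw [hhalf, hquot]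
        exact_mod_cast this
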